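/- Let $\mathbb K$ be an algebraically closed field of characteristic $0$, let $G=GL_3(\mathbb K)$ act diagonally on $(\mathbb P^2)^4$ (with $\mathbb P^2=\mathbb P(\mathbb K^3)$, standard basis $e_1,e_2,e_3$), and give $(\mathbb P^2)^4$ its Zariski topology. For $v=([v_1],\dots,[v_4])$ put $\pi(v)\colon 2^{\{1,2,3,4\}}\to\mathbb N$, $\pi(v)(I)=\dim\operatorname{span}\{v_i: i\in I\}$. Write $\varphi\le\psi$ if $\varphi(I)\le\psi(I)$ for all $I$. Define maps $2^{\{1,2,3,4\}}\to\mathbb N$, with $\{i,j,k,l\}=\{1,2,3,4\}$, by \begin{align*} \varphi[8](I)&=\min\{\#I,3\}, & \varphi[6](I)&=\min\{\#I,2\}, & \varphi[2](I)&=\min\{\#I,1\},\\ \varphi[7;i](I)&=\#(I\cap\{i\})+\min\{\#(I\setminus\{i\}),2\}, & & & \varphi[4;i](I)&=\#(I\cap\{i\})+\min\{\#(I\setminus\{i\}),1\},\\ \varphi[6;k,l](I)&=\#(I\cap\{i,j\})+\min\{\#(I\cap\{k,l\}),1\}, & & & \varphi[4;i,j](I)&=\min\{\#(I\cap\{i,j\}),1\}+\min\{\#(I\cap\{k,l\}),1\},\\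 \varphi[5;i,j](I)&=\min\{\#(I/{i\sim j}),2\}, \end{align*} where $I/{i\sim j}$ is the image of $I$ after identifying $i$ with $j$. Let $(\mathbb P^1)'=\mathbb P^1\setminus\{[e_1],[e_2],[e_1+e_2]\}$ (that is, $\mathbb P^1\setminus\{0,1,\infty\}$), and for $p=[p_1e_1+p_2e_2]\in\mathbb P^1$ let $$\mathcal O(5;p)=\{([x_1],[x_2],[x_1+x_2],[p_1x_1+p_2x_2])\in(\mathbb P^2)^4 : [x_1]\ne[x_2]\}.$$ 1. The map $\pi$ is $G$-invariant. 2. The image of $\pi$ consists exactly of the maps $\varphi[8]$, $\varphi[7;i]$, $\varphi[6;i,j]$, $\varphi[6]$, $\varphi[5;i,j]$, $\varphi[4;i,j]$, $\varphi[4;i]$, $\varphi[2]$ ($i,j\in\{1,2,3,4\}$, $i<j$). 3. For each of these maps $\varphi\neq\varphi[6]$ the fibre $\pi^{-1}(\varphi)$ is a single $G$-orbit. Representatives are $[e_1,e_1,e_1,e_1]$ for $\varphi[2]$, $[e_1,e_2,e_2,e_2]$ for $\varphi[4;1]$, $[e_1,e_1,e_2,e_2]$ for $\varphi[4;1,2]$,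 $[e_1,e_1,e_2,e_1+e_2]$ for $\varphi[5;1,2]$, $[e_1,e_2,e_3,e_3]$ for $\varphi[6;3,4]$, $[e_1,e_2,e_3,e_2+e_3]$ for $\varphi[7;1]$, $[e_1,e_2,e_3,e_1+e_2+e_3]$ for $\varphi[8]$, and the tuples obtained from these by permuting the four positions for the other index choices. The fibre $\pi^{-1}(\varphi[6])$ is the disjoint union of the infinitely many sets $\mathcal O(5;p)$, $p\in(\mathbb P^1)'$, and each of these is a single $G$-orbit, $\mathcal O(5;p)=G\cdot[e_1,e_2,e_1+e_2,p_1e_1+p_2e_2]$, of dimension $5$. 4. For every $\varphi$ in the image of $\pi$, $\overline{\pi^{-1}(\varphi)}=\bigcup_{\psi\le\varphi}\pi^{-1}(\psi)$. For every $p\in(\mathbb P^1)'$, $$\overline{\mathcal O(5;p)}=\mathcal O(5;p)\ \amalg\ \coprod_{i=1}^4\pi^{-1}(\varphi[4;i])\ \amalg\ \pi^{-1}(\varphi[2]).$$ Moreover, for fixed $p\in(\mathbb P^1)'$, the closure relations among all the fibres over the listed maps and the orbit $\mathcal O(5;p)$ are given by the Hasse diagram with the following downward edges (a map stands for its fibre;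 $i,j,k$ are pairwise distinct): $\varphi[8]\to\varphi[7;i]$; $\varphi[7;i]\to\varphi[6;j,k]$; $\varphi[7;i]\to\varphi[6]$; $\varphi[6;i,j]\to\varphi[5;i,j]$; $\varphi[6]\to\varphi[5;i,j]$; $\varphi[6]\to\mathcal O(5;p)$; $\varphi[5;i,j]\to\varphi[4;i,j]$; $\varphi[5;i,j]\to\varphi[4;k]$; $\mathcal O(5;p)\to\varphi[4;i]$; $\varphi[4;i,j]\to\varphi[2]$; $\varphi[4;i]\to\varphi[2]$. That is, the closure of the set at a vertex $a$ is the union of the sets at all vertices reachable from $a$ by a (possibly empty) downward path, and the set at a vertex $b$ is contained in the closure of the set at $a$ if and only if $b$ is reachable from $a$. -/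

import Mathlib

open scoped LinearAlgebra.Projectivization MatrixGroups

noncomputable section

namespace QuadProj

/-! ### Multiple projective spaces and their Zariski topology -/

/-- The multiple projective space `(ℙ^(n-1))^m` over `K`, i.e. `m`-tuples of lines in `K^n`. -/
abbrev MultiProj (K : Type*) [Field K] (n m : ℕ) : Type _ := Fin m → ℙ K (Fin n → K)

/-- A polynomial in the entries of an `n × m`-matrix (the variable `(i, k)` is the `k`-th coordinate
of the `i`-th column) is multihomogeneous of multidegree `d` if it is homogeneous of degree `d i`
in the entries of the `i`-th column, for every `i`. -/
def IsMultihomogeneous {K : Type*} [Field K] {n m : ℕ} (f : MvPolynomial (Fin m × Fin n) K)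
    (d : Fin m → ℕ) : Prop :=
  MvPolynomial.IsWeightedHomogeneous (fun ik : Fin m × Fin n => (Pi.single ik.1 1 : Fin m → ℕ)) f d

/-- The polynomial `f` vanishes at every matrix whose columns represent the points of `v`. -/
def VanishesAt {K : Type*} [Field K] {n m : ℕ} (f : MvPolynomial (Fin m × Fin n) K)
    (v : MultiProj K n m) : Prop :=
  ∀ x : Fin m → Fin n → K, (∀ i, ∃ h : x i ≠ 0, Projectivization.mk K (x i) h = v i) →
    MvPolynomial.eval (fun ik => x ik.1 ik.2) f = 0

/-- The common zero set in `(ℙ^(n-1))^m` of a set of polynomials. -/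
def zeroLocus {K : Type*} [Field K] {n m : ℕ} (S : Set (MvPolynomial (Fin m × Fin n) K)) :
    Set (MultiProj K n m) :=
  {v | ∀ f ∈ S, VanishesAt f v}

/-- Rescaling the columns of a matrix by `c` multiplies the value of a multihomogeneous polynomial
of multidegree `d` by `∏ i, c i ^ d i`. -/
theorem IsMultihomogeneous.eval_smul {K : Type*} [Field K] {n m : ℕ}
    {f : MvPolynomial (Fin m × Fin n) K} {d : Fin m → ℕ} (hf : IsMultihomogeneous f d)
    (c : Fin m → K) (x : Fin m → Fin n → K) :
    MvPolynomial.eval (fun ik : Fin m × Fin n => c ik.1 * x ik.1 ik.2) f =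
      (∏ i, c i ^ d i) * MvPolynomial.eval (fun ik : Fin m × Fin n => x ik.1 ik.2) f := by
  classical
  rw [MvPolynomial.eval_eq, MvPolynomial.eval_eq, Finset.mul_sum]
  refine Finset.sum_congr rfl fun e he => ?_
  have h := hf (MvPolynomial.mem_support_iff.mp he)
  have h2 : ∀ j, ∑ k, e (j, k) = d j := by
    intro j
    rw [← h, Finsupp.weight_apply, Finsupp.sum_fintype _ _ (by simp), Finset.sum_apply,
      Fintype.sum_prod_type, Finset.sum_eq_single j]
    · simp
    · intro i _ hij
      simp [Ne.symm hij]
    · simp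
  have h3 : ∏ ik ∈ e.support, c ik.1 ^ e ik = ∏ i, c i ^ d i := by
    rw [Finset.prod_subset (Finset.subset_univ _) (by
      intro ik _ hik
      simp [Finsupp.notMem_support_iff.mp hik]), Fintype.prod_prod_type]
    refine Finset.prod_congr rfl fun i _ => ?_
    rw [← h2 i, ← Finset.prod_pow_eq_pow_sum]
  simp only [mul_pow, Finset.prod_mul_distrib]
  rw [h3]
  ring

/-- For a multihomogeneous polynomial, vanishing may be tested on one choice of representatives. -/
theorem vanishesAt_iff {K : Type*} [Field K] {n m : ℕ}
    {f : MvPolynomial (Fin m × Fin n) K} {d : Fin m → ℕ} (hf : IsMultihomogeneous f d)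
    {v : MultiProj K n m} {x : Fin m → Fin n → K}
    (hx : ∀ i, ∃ h : x i ≠ 0, Projectivization.mk K (x i) h = v i) :
    VanishesAt f v ↔ MvPolynomial.eval (fun ik : Fin m × Fin n => x ik.1 ik.2) f = 0 := by
  refine ⟨fun h => h x hx, fun h y hy => ?_⟩
  have hc : ∀ i, ∃ a : K, a • x i = y i := by
    intro i
    obtain ⟨h1, e1⟩ := hx i
    obtain ⟨h2, e2⟩ := hy i
    exact (Projectivization.mk_eq_mk_iff' K (y i) (x i) h2 h1).mp (e2.trans e1.symm)
  choose c hc using hc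
  have := hf.eval_smul c x
  rw [h, mul_zero] at this
  rw [← this]
  congr 2
  funext ik
  rw [← hc]
  rfl

theorem exists_rep {K : Type*} [Field K] {n m : ℕ} (v : MultiProj K n m) :
    ∃ x : Fin m → Fin n → K, ∀ i, ∃ h : x i ≠ 0, Projectivization.mk K (x i) h = v i :=
  ⟨fun i => (v i).rep, fun i => ⟨(v i).rep_nonzero, (v i).mk_rep⟩⟩

/-- The Zariski topology on `(ℙ^(n-1))^m`: the closed sets are the common zero sets of sets of
multihomogeneous polynomials. -/
instance zariskiTopology (K : Type*) [Field K] (n m : ℕ) : TopologicalSpace (MultiProj K n m) :=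
  TopologicalSpace.ofClosed
    {Z | ∃ S : Set (MvPolynomial (Fin m × Fin n) K),
      (∀ f ∈ S, ∃ d, IsMultihomogeneous f d) ∧ Z = zeroLocus S}
    (by
      refine ⟨{1}, ?_, ?_⟩
      · rintro f rfl
        exact ⟨0, MvPolynomial.isWeightedHomogeneous_one _ _⟩
      · symm
        rw [Set.eq_empty_iff_forall_notMem]
        intro v hv
        obtain ⟨x, hx⟩ := exists_rep v
        simpa using hv 1 rfl x hx)
    (by
      intro A hA
      have hA' : ∀ Z : Set (MultiProj K n m), ∃ S : Set (MvPolynomial (Fin m × Fin n) K), Z ∈ A →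
          (∀ f ∈ S, ∃ d, IsMultihomogeneous f d) ∧ Z = zeroLocus S := fun Z => by
        by_cases hZ : Z ∈ A
        · obtain ⟨S, hS⟩ := hA hZ
          exact ⟨S, fun _ => hS⟩
        · exact ⟨∅, fun h => absurd h hZ⟩
      choose S hS using hA'
      refine ⟨⋃ Z ∈ A, S Z, ?_, ?_⟩
      · intro f hf
        simp only [Set.mem_iUnion] at hf
        obtain ⟨Z, hZ, hf⟩ := hf
        exact (hS Z hZ).1 f hf
      · ext v
        simp only [Set.mem_sInter, zeroLocus, Set.mem_ofPred_eq, Set.mem_iUnion]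
        constructor
        · rintro h f ⟨Z, hZ, hf⟩
          have := h Z hZ
          rw [(hS Z hZ).2] at this
          exact this f hf
        · intro h Z hZ
          rw [(hS Z hZ).2]
          exact fun f hf => h f ⟨Z, hZ, hf⟩)
    (by
      rintro _ ⟨S, hS, rfl⟩ _ ⟨T, hT, rfl⟩
      refine ⟨{h | ∃ f ∈ S, ∃ g ∈ T, h = f * g}, ?_, ?_⟩
      · rintro _ ⟨f, hf, g, hg, rfl⟩
        obtain ⟨d, hd⟩ := hS f hf
        obtain ⟨e, he⟩ := hT g hg
        exact ⟨d + e, hd.mul he⟩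
      · ext v
        constructor
        · rintro (h | h)
          · rintro _ ⟨f, hf, g, hg, rfl⟩ x hx
            rw [map_mul, h f hf x hx, zero_mul]
          · rintro _ ⟨f, hf, g, hg, rfl⟩ x hx
            rw [map_mul, h g hg x hx, mul_zero]
        · intro h
          by_contra hcon
          simp only [Set.mem_union, not_or, zeroLocus, Set.mem_ofPred_eq, not_forall] at hcon
          obtain ⟨⟨f, hf, hfv⟩, g, hg, hgv⟩ := hcon
          obtain ⟨d, hd⟩ := hS f hf
          obtain ⟨e, he⟩ := hT g hg
          obtain ⟨x, hx⟩ := exists_rep v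
          rw [vanishesAt_iff hd hx] at hfv
          rw [vanishesAt_iff he hx] at hgv
          have := h (f * g) ⟨f, hf, g, hg, rfl⟩ x hx
          rw [map_mul] at this
          exact (mul_ne_zero hfv hgv) this)

/-! ### The rank map -/

/-- `rankMap v I` is the dimension of the span of the lines `v i`, `i ∈ I`. -/
def rankMap {K : Type*} [Field K] {n m : ℕ} (v : MultiProj K n m) : Finset (Fin m) → ℕ :=
  fun I => Module.finrank K (⨆ i ∈ I, (v i).submodule : Submodule K (Fin n → K))

/-- The fibre of the rank map on `(ℙ²)⁴` over `φ`. -/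
def fibre (K : Type*) [Field K] (φ : Finset (Fin 4) → ℕ) : Set (MultiProj K 3 4) :=
  rankMap ⁻¹' {φ}

/-! ### The maps `φ[∗]`; the index set `{1,2,3,4}` is written as `Fin 4 = {0,1,2,3}` -/

/-- `φ[2]`, from the partition `{1,2,3,4}` with rank `1`. -/
def phi2 : Finset (Fin 4) → ℕ := fun I => min I.card 1

/-- `φ[4;i]`, from the partition `{i}, {j,k,l}` with ranks `1, 1`. -/
def phi4s (i : Fin 4) : Finset (Fin 4) → ℕ :=
  fun I => min (I ∩ {i}).card 1 + min (I \ {i}).card 1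

/-- `φ[4;i,j]`, from the partition `{i,j}, {k,l}` with ranks `1, 1`. -/
def phi4p (i j : Fin 4) : Finset (Fin 4) → ℕ :=
  fun I => min (I ∩ {i, j}).card 1 + min (I \ {i, j}).card 1

/-- `φ[5;i,j]`, where `I / i ∼ j` is the image of `I` after identifying `j` with `i`. -/
def phi5 (i j : Fin 4) : Finset (Fin 4) → ℕ :=
  fun I => min (I.image fun k => if k = j then i else k).card 2

/-- `φ[6]`. -/
def phi6 : Finset (Fin 4) → ℕ := fun I => min I.card 2

/-- `φ[6;k,l]`, from the partition `{i}, {j}, {k,l}` with ranks `1, 1, 1`. -/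
def phi6p (k l : Fin 4) : Finset (Fin 4) → ℕ :=
  fun I => (∑ i ∈ ({k, l} : Finset (Fin 4))ᶜ, min (I ∩ {i}).card 1) + min (I ∩ {k, l}).card 1

/-- `φ[7;i]`, from the partition `{i}, {j,k,l}` with ranks `1, 2`. -/
def phi7 (i : Fin 4) : Finset (Fin 4) → ℕ :=
  fun I => min (I ∩ {i}).card 1 + min (I \ {i}).card 2

/-- `φ[8]`, from the partition `{1,2,3,4}` with rank `3`. -/
def phi8 : Finset (Fin 4) → ℕ := fun I => min I.card 3

/-- The explicit list of all the maps `φ[∗]`. -/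
def phiList : Set (Finset (Fin 4) → ℕ) :=
  {φ | φ = phi8 ∨ (∃ i, φ = phi7 i) ∨ (∃ i j, i < j ∧ φ = phi6p i j) ∨ φ = phi6 ∨
    (∃ i j, i < j ∧ φ = phi5 i j) ∨ (∃ i j, i < j ∧ φ = phi4p i j) ∨ (∃ i, φ = phi4s i) ∨
    φ = phi2}

/-! ### Orbits -/

/-- The `GL₃`-orbit of a point of `(ℙ²)⁴` under the diagonal action. -/
def diagOrbit {K : Type*} [Field K] (v : MultiProj K 3 4) : Set (MultiProj K 3 4) :=
  MulAction.orbit (GL (Fin 3) K) v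

/-- The tuple `[x₁, x₂, x₃, x₄]` of lines spanned by nonzero vectors. -/
def tuple {K : Type*} [Field K] (x : Fin 4 → Fin 3 → K) (hx : ∀ i, x i ≠ 0) : MultiProj K 3 4 :=
  fun i => Projectivization.mk K (x i) (hx i)

/-- `[e₁, e₁, e₁, e₁]` -/
def rep2 (K : Type*) [Field K] : MultiProj K 3 4 :=
  tuple ![![1, 0, 0], ![1, 0, 0], ![1, 0, 0], ![1, 0, 0]] (by intro i; fin_cases i <;> simp)

/-- `[e₁, e₂, e₂, e₂]` -/
def rep4s (K : Type*) [Field K] : MultiProj K 3 4 :=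
  tuple ![![1, 0, 0], ![0, 1, 0], ![0, 1, 0], ![0, 1, 0]] (by intro i; fin_cases i <;> simp)

/-- `[e₁, e₁, e₂, e₂]` -/
def rep4p (K : Type*) [Field K] : MultiProj K 3 4 :=
  tuple ![![1, 0, 0], ![1, 0, 0], ![0, 1, 0], ![0, 1, 0]] (by intro i; fin_cases i <;> simp)

/-- `[e₁, e₁, e₂, e₁ + e₂]` -/
def rep5 (K : Type*) [Field K] : MultiProj K 3 4 :=
  tuple ![![1, 0, 0], ![1, 0, 0], ![0, 1, 0], ![1, 1, 0]] (by intro i; fin_cases i <;> simp)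

/-- `[e₁, e₂, e₃, e₃]` -/
def rep6p (K : Type*) [Field K] : MultiProj K 3 4 :=
  tuple ![![1, 0, 0], ![0, 1, 0], ![0, 0, 1], ![0, 0, 1]] (by intro i; fin_cases i <;> simp)

/-- `[e₁, e₂, e₃, e₂ + e₃]` -/
def rep7 (K : Type*) [Field K] : MultiProj K 3 4 :=
  tuple ![![1, 0, 0], ![0, 1, 0], ![0, 0, 1], ![0, 1, 1]] (by intro i; fin_cases i <;> simp)

/-- `[e₁, e₂, e₃, e₁ + e₂ + e₃]` -/
def rep8 (K : Type*) [Field K] : MultiProj K 3 4 :=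
  tuple ![![1, 0, 0], ![0, 1, 0], ![0, 0, 1], ![1, 1, 1]] (by intro i; fin_cases i <;> simp)

/-- `v` with its entries permuted: entry `i` of `v` is moved to position `σ i`. -/
def permTuple {K : Type*} [Field K] (σ : Equiv.Perm (Fin 4)) (v : MultiProj K 3 4) :
    MultiProj K 3 4 :=
  fun i => v (σ.symm i)

/-- `ℙ¹ ∖ {0, 1, ∞} = ℙ¹ ∖ {[e₁], [e₂], [e₁ + e₂]}`. -/
def linePrime (K : Type*) [Field K] : Set (ℙ K (Fin 2 → K)) :=
  {p | p ≠ Projectivization.mk K ![1, 0] (by simp) ∧ p ≠ Projectivization.mk K ![0, 1] (by simp) ∧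
    p ≠ Projectivization.mk K ![1, 1] (by simp)}

/-- `[e₁, e₂, e₁ + e₂, p]` for `p = [p₁ : p₂]`, placed in `ℙ²` as `[p₁ e₁ + p₂ e₂]`. -/
def repLine {K : Type*} [Field K] (p : ℙ K (Fin 2 → K)) : MultiProj K 3 4 :=
  tuple ![![1, 0, 0], ![0, 1, 0], ![1, 1, 0], ![p.rep 0, p.rep 1, 0]] (by
    intro i
    fin_cases i <;> simp
    intro h0 h1
    apply p.rep_nonzero
    funext k
    fin_cases k
    · exact h0
    · exact h1)

/-- `O(5;p)`: the tuples `[x₁, x₂, x₃, x₄]` with `[x₁] ≠ [x₂]`, `x₃ = x₁ + x₂` and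
`x₄ = p₁ x₁ + p₂ x₂`, where `p = [p₁ : p₂]`. -/
def orbit5 {K : Type*} [Field K] (p : ℙ K (Fin 2 → K)) : Set (MultiProj K 3 4) :=
  {v | ∃ x : Fin 4 → Fin 3 → K, (∀ i, ∃ h : x i ≠ 0, Projectivization.mk K (x i) h = v i) ∧
    v 0 ≠ v 1 ∧ x 2 = x 0 + x 1 ∧ x 3 = p.rep 0 • x 0 + p.rep 1 • x 1}

/-! ### The Hasse diagram -/

/-- The vertices of the diagram: a map `φ[∗]`, standing for its fibre, or `O(5;p)`. -/
inductive Node : Type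
  | fib (φ : Finset (Fin 4) → ℕ) : Node
  | orb : Node

/-- The vertices that occur in the diagram. -/
def diagram : Set Node := insert Node.orb (Node.fib '' phiList)

/-- The subset of `(ℙ²)⁴` that a vertex stands for. -/
def stratum {K : Type*} [Field K] (p : ℙ K (Fin 2 → K)) : Node → Set (MultiProj K 3 4)
  | .fib φ => fibre K φ
  | .orb => orbit5 p

/-- The edges of the diagram, directed downwards. -/
inductive Edge : Node → Node → Prop
  | e8_7 (i : Fin 4) : Edge (.fib phi8) (.fib (phi7 i))
  | e7_6p (i j k : Fin 4) : i ≠ j → i ≠ k → j < k → Edge (.fib (phi7 i)) (.fib (phi6p j k))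
  | e7_6 (i : Fin 4) : Edge (.fib (phi7 i)) (.fib phi6)
  | e6p_5 (i j : Fin 4) : i < j → Edge (.fib (phi6p i j)) (.fib (phi5 i j))
  | e6_5 (i j : Fin 4) : i < j → Edge (.fib phi6) (.fib (phi5 i j))
  | e6_orb : Edge (.fib phi6) .orb
  | e5_4p (i j : Fin 4) : i < j → Edge (.fib (phi5 i j)) (.fib (phi4p i j))
  | e5_4s (i j k : Fin 4) : i < j → k ≠ i → k ≠ j → Edge (.fib (phi5 i j)) (.fib (phi4s k))
  | orb_4s (i : Fin 4) : Edge .orb (.fib (phi4s i))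
  | e4p_2 (i j : Fin 4) : i < j → Edge (.fib (phi4p i j)) (.fib phi2)
  | e4s_2 (i : Fin 4) : Edge (.fib (phi4s i)) (.fib phi2)

end QuadProj

end

open QuadProj

/-!
The rank map of a tuple `v` of four points in the plane is the rank function of a matroid of rank at
most `3` without loops, so it is determined by two kinds of data: which pairs of points coincide,
and which triples are collinear. In terms of a matrix `x` whose columns represent `v`, these are the
vanishing of `2 × 2`-minors of pairs of columns and of the determinants `det3` of triples of columns
(`Represents.mem_fibre_iff`, `Represents.rankMap_le_iff`). Submodularity of the rank leaves only the
maps of `phiList` (`rankMap_mem_phiList`).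

*Orbits.* In a fibre other than the one over `phi6`, suitable multiples of three of the columns form
a basis of `K³` in which all four points have prescribed coordinates, so that the fibre is one
orbit. By `permTuple_mem_fibre` one choice of indices is enough. Over `phi6` the points are four
distinct points of a line; the first three are normalized in the same way, and the coordinates `p`
of the fourth remain as an invariant, the cross-ratio. Hence the fibre is the union of the `O(5;p)`,
which are separated by the equations `HasCrossRatio`.

*Closures.* The set `{v | rankMap v ≤ φ}` is closed, as it is given by minors
(`isClosed_rankMap_le`), and so is the set with given cross-ratio. A point of rank at most `2` which
satisfies the equations for the cross-ratio `p ≠ 0, 1, ∞` lies in `O(5;p)` or has three equal entries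
(`mem_orbit5_or_of_hasCrossRatio`). This bounds the closures from above. From below, each edge of
the diagram is realized by a line of matrices `a + t b`, whose general member represents a point of
the upper stratum and whose member at `t = 0` represents a point of the lower one
(`mem_closure_of_line`, `stratum_subset_of_edge`). The order on `phiList` is generated by the edges
(`reachable_of_le`), a finite check.

*Dimension.* The first coordinates of the first three points being nonzero, `O(5;p)` has the five
affine coordinates `a, b, c, d, t` with `x₀ = (1, a, b)`, `x₁ = (1, c, d)` and `t` the ratio of the
first two coordinates of `x₂`. They define an inducing map to the spectrum of a polynomial ring in
five variables (`isInducing_chartMap`), and the translates of this chart cover `O(5;p)`, so that the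
dimension is at most `5`. The closures of the coordinate subspaces of the chart, which are
irreducible as closures of images of open subsets of affine spaces, form a chain of length `5`.
-/

namespace QuadProj

variable {K : Type*} [Field K]

/-! ### Representing matrices and the rank map -/

/-- The columns of the matrix `x` are nonzero and represent the points of `v`. -/
def Represents {n m : ℕ} (x : Fin m → Fin n → K) (v : MultiProj K n m) : Prop :=
  ∀ i, ∃ h : x i ≠ 0, Projectivization.mk K (x i) h = v i

theorem Represents.ne_zero {n m : ℕ} {x : Fin m → Fin n → K} {v : MultiProj K n m}
    (hx : Represents x v) (i : Fin m) : x i ≠ 0 := (hx i).1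

theorem represents_tuple (x : Fin 4 → Fin 3 → K) (hx : ∀ i, x i ≠ 0) :
    Represents x (tuple x hx) := fun i => ⟨hx i, rfl⟩

theorem Represents.congr {n m : ℕ} {x : Fin m → Fin n → K} {v w : MultiProj K n m}
    (hv : Represents x v) (hw : Represents x w) : v = w :=
  funext fun i => ((hv i).2).symm.trans (hw i).2

theorem Represents.permTuple {x : Fin 4 → Fin 3 → K} {v : MultiProj K 3 4} (hx : Represents x v)
    (σ : Equiv.Perm (Fin 4)) : Represents (fun i => x (σ.symm i)) (permTuple σ v) :=
  fun i => hx (σ.symm i)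

theorem Represents.smul {m : ℕ} {x : Fin m → Fin 3 → K} {v : MultiProj K 3 m}
    (hx : Represents x v) (g : GL (Fin 3) K) : Represents (fun i => g • x i) (g • v) := by
  intro i
  obtain ⟨h, e⟩ := hx i
  refine ⟨(smul_ne_zero_iff_ne g).mpr h, ?_⟩
  rw [← Projectivization.smul_mk g h, e]
  rfl

theorem Represents.scale {n m : ℕ} {x y : Fin m → Fin n → K} {v : MultiProj K n m}
    (hx : Represents x v) (c : Fin m → K) (hc : ∀ i, c i ≠ 0) (hy : ∀ i, y i = c i • x i) :
    Represents y v := by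
  intro i
  obtain ⟨h, e⟩ := hx i
  have h' : y i ≠ 0 := by rw [hy]; exact smul_ne_zero (hc i) h
  exact ⟨h', ((Projectivization.mk_eq_mk_iff' K _ _ h' h).mpr ⟨c i, (hy i).symm⟩).trans e⟩

theorem Represents.eq_iff_minors {n m : ℕ} {x : Fin m → Fin n → K} {v : MultiProj K n m}
    (hx : Represents x v) (i j : Fin m) :
    v i = v j ↔ ∀ a b, x i a * x j b = x i b * x j a := by
  obtain ⟨hi, ei⟩ := hx i
  obtain ⟨hj, ej⟩ := hx j
  rw [← ei, ← ej, Projectivization.mk_eq_mk_iff']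
  constructor
  · rintro ⟨c, hc⟩ a b
    rw [← hc]
    simp only [Pi.smul_apply, smul_eq_mul]
    ring
  · intro h
    obtain ⟨a, ha⟩ := Function.ne_iff.mp hj
    refine ⟨x i a / x j a, funext fun b => ?_⟩
    have ha' : x j a ≠ 0 := ha
    simp only [Pi.smul_apply, smul_eq_mul]
    field_simp
    rw [h a b]
    ring

/-- The determinant of three vectors in `K³`. -/
def det3 (x y z : Fin 3 → K) : K := (Matrix.of ![x, y, z]).det

theorem det3_eq (x y z : Fin 3 → K) : det3 x y z =
    x 0 * y 1 * z 2 - x 0 * y 2 * z 1 - x 1 * y 0 * z 2 + x 1 * y 2 * z 0 + x 2 * y 0 * z 1 -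
      x 2 * y 1 * z 0 := by
  simp [det3, Matrix.det_fin_three]

theorem det3_ne_zero_iff (x y z : Fin 3 → K) :
    det3 x y z ≠ 0 ↔ LinearIndependent K ![x, y, z] := by
  rw [det3, ← isUnit_iff_ne_zero, ← Matrix.isUnit_iff_isUnit_det,
    ← Matrix.linearIndependent_rows_iff_isUnit]
  rfl

theorem det3_smul (g : GL (Fin 3) K) (x y z : Fin 3 → K) :
    det3 (g • x) (g • y) (g • z) = (g : Matrix (Fin 3) (Fin 3) K).det * det3 x y z := by
  have h : (Matrix.of ![g • x, g • y, g • z]) =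
      Matrix.of ![x, y, z] * (g : Matrix (Fin 3) (Fin 3) K).transpose := by
    ext i j
    fin_cases i <;>
      simp [Matrix.mul_apply, Units.smul_def, Matrix.smul_eq_mulVec, Matrix.mulVec, dotProduct,
        mul_comm]
  rw [det3, h, Matrix.det_mul, Matrix.det_transpose, mul_comm]
  rfl

/-- Two non-proportional vectors extend to a basis of `K³`. -/
theorem exists_det3_ne_zero {x y : Fin 3 → K} (h : ¬ ∀ a b, x a * y b = x b * y a) :
    ∃ z, det3 x y z ≠ 0 := by
  contrapose! h
  have e0 := h ![1, 0, 0]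
  have e1 := h ![0, 1, 0]
  have e2 := h ![0, 0, 1]
  simp only [det3_eq, Matrix.cons_val] at e0 e1 e2
  intro a b
  fin_cases a <;> fin_cases b <;> simp only [Fin.zero_eta, Fin.mk_one, Fin.reduceFinMk] <;>
    first
      | linear_combination e0
      | linear_combination -e0
      | linear_combination e1
      | linear_combination -e1
      | linear_combination e2
      | linear_combination -e2

/-- The span whose dimension is `rankMap v I`. -/
theorem Represents.iSup_eq_span {m : ℕ} {x : Fin m → Fin 3 → K} {v : MultiProj K 3 m}
    (hx : Represents x v) (I : Finset (Fin m)) :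
    (⨆ i ∈ I, (v i).submodule : Submodule K (Fin 3 → K)) = Submodule.span K (x '' I) := by
  rw [← Set.biUnion_of_singleton (x '' (I : Set (Fin m))), Submodule.span_iUnion₂, iSup_image]
  refine iSup_congr fun i => iSup_congr fun _ => ?_
  obtain ⟨h, e⟩ := hx i
  rw [← e, Projectivization.submodule_mk]

theorem rankMap_le_three {m : ℕ} (v : MultiProj K 3 m) (I : Finset (Fin m)) :
    rankMap v I ≤ 3 :=
  (Submodule.finrank_le _).trans (by simp)

theorem rankMap_empty {m : ℕ} (v : MultiProj K 3 m) : rankMap v ∅ = 0 := by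
  simp [rankMap]

theorem one_le_rankMap {m : ℕ} (v : MultiProj K 3 m) {I : Finset (Fin m)} (hI : I.Nonempty) :
    1 ≤ rankMap v I := by
  obtain ⟨i, hi⟩ := hI
  rw [← (v i).finrank_submodule]
  exact Submodule.finrank_mono (le_iSup₂_of_le i hi le_rfl)

theorem rankMap_le_one_iff {m : ℕ} (v : MultiProj K 3 m) (I : Finset (Fin m)) :
    rankMap v I ≤ 1 ↔ ∀ i ∈ I, ∀ j ∈ I, v i = v j := by
  constructor
  · intro h i hi j hj
    have key : ∀ k ∈ I, (v k).submodule = (⨆ i ∈ I, (v i).submodule : Submodule K _) := by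
      intro k hk
      refine Submodule.eq_of_le_of_finrank_le (le_iSup₂_of_le k hk le_rfl) ?_
      rw [(v k).finrank_submodule]
      exact h
    exact Projectivization.submodule_injective ((key i hi).trans (key j hj).symm)
  · intro h
    rcases I.eq_empty_or_nonempty with rfl | ⟨i, hi⟩
    · simp [rankMap_empty]
    · rw [← (v i).finrank_submodule]
      exact Submodule.finrank_mono (iSup₂_le fun j hj => by rw [h i hi j hj])

theorem Represents.rankMap_le_two_iff {m : ℕ} {x : Fin m → Fin 3 → K} {v : MultiProj K 3 m}
    (hx : Represents x v) (I : Finset (Fin m)) :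
    rankMap v I ≤ 2 ↔ ∀ i ∈ I, ∀ j ∈ I, ∀ k ∈ I, det3 (x i) (x j) (x k) = 0 := by
  constructor
  · intro h i hi j hj k hk
    by_contra hne
    rw [← ne_eq, det3_ne_zero_iff] at hne
    have h3 : Module.finrank K (Submodule.span K (Set.range ![x i, x j, x k])) = 3 := by
      rw [finrank_span_eq_card hne]; rfl
    have hle : Submodule.span K (Set.range ![x i, x j, x k]) ≤
        (⨆ i ∈ I, (v i).submodule : Submodule K (Fin 3 → K)) := by
      rw [hx.iSup_eq_span]
      refine Submodule.span_mono ?_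
      rintro _ ⟨a, rfl⟩
      fin_cases a
      · exact ⟨i, hi, rfl⟩
      · exact ⟨j, hj, rfl⟩
      · exact ⟨k, hk, rfl⟩
    have := Submodule.finrank_mono hle
    rw [h3] at this
    exact absurd (this.trans h) (by norm_num)
  · intro h
    by_cases hI : ∀ i ∈ I, ∀ j ∈ I, v i = v j
    · exact ((rankMap_le_one_iff v I).mpr hI).trans one_le_two
    push Not at hI
    obtain ⟨i, hi, j, hj, hij⟩ := hI
    -- all columns indexed by `I` lie in the kernel of `det3 (x i) (x j)`
    let ℓ : (Fin 3 → K) →ₗ[K] K :=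
      { toFun := fun z => det3 (x i) (x j) z
        map_add' := fun z w => by simp only [det3_eq, Pi.add_apply]; ring
        map_smul' := fun c z => by
          simp only [det3_eq, Pi.smul_apply, smul_eq_mul, RingHom.id_apply]; ring }
    have hℓ : ℓ ≠ 0 := by
      intro h0
      apply hij
      rw [hx.eq_iff_minors]
      by_contra hne
      obtain ⟨z, hz⟩ := exists_det3_ne_zero hne
      exact hz (LinearMap.congr_fun h0 z)
    have hle : (⨆ i ∈ I, (v i).submodule : Submodule K (Fin 3 → K)) ≤ LinearMap.ker ℓ := by
      rw [hx.iSup_eq_span, Submodule.span_le]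
      rintro _ ⟨k, hk, rfl⟩
      exact h i hi j hj k hk
    refine (Submodule.finrank_mono hle).trans ?_
    have hr := ℓ.finrank_range_add_finrank_ker
    have hsurj : Module.finrank K (LinearMap.range ℓ) = 1 := by
      rw [LinearMap.range_eq_top.mpr (LinearMap.surjective hℓ)]; simp
    rw [hsurj, Module.finrank_pi, Fintype.card_fin] at hr
    omega

/-- The rank map is determined by the coincidences of points and the collinear triples. -/
theorem rankMap_eq_of {m : ℕ} {x y : Fin m → Fin 3 → K} {v w : MultiProj K 3 m}
    (hx : Represents x v) (hy : Represents y w) {τ : Fin m → Fin m}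
    (h2 : ∀ i j, v i = v j ↔ w (τ i) = w (τ j))
    (h3 : ∀ i j k, det3 (x i) (x j) (x k) = 0 ↔ det3 (y (τ i)) (y (τ j)) (y (τ k)) = 0)
    (I : Finset (Fin m)) : rankMap v I = rankMap w (I.image τ) := by
  have a1 := rankMap_le_one_iff v I
  have b1 := rankMap_le_one_iff w (I.image τ)
  have a2 := hx.rankMap_le_two_iff I
  have b2 := hy.rankMap_le_two_iff (I.image τ)
  simp only [Finset.forall_mem_image, ← h2, ← h3] at b1 b2
  rw [← a1] at b1
  rw [← a2] at b2
  have a3 := rankMap_le_three v I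
  have b3 := rankMap_le_three w (I.image τ)
  rcases I.eq_empty_or_nonempty with rfl | hI
  · simp [rankMap_empty]
  · have := one_le_rankMap v hI
    have := one_le_rankMap w (hI.image τ)
    omega

theorem rankMap_smul (g : GL (Fin 3) K) {m : ℕ} (v : MultiProj K 3 m) :
    rankMap (g • v) = rankMap v := by
  obtain ⟨x, hx⟩ := exists_rep v
  replace hx : Represents x v := hx
  funext I
  have := rankMap_eq_of (hx.smul g) hx (τ := id) (fun i j => ?_) (fun i j k => ?_) I
  · simpa using this
  · exact (MulAction.injective g).eq_iff (a := v i) (b := v j)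
  · rw [det3_smul, mul_eq_zero, or_iff_right]
    · rfl
    · exact (Matrix.isUnits_det_units g).ne_zero

theorem rankMap_permTuple (σ : Equiv.Perm (Fin 4)) (v : MultiProj K 3 4)
    (I : Finset (Fin 4)) : rankMap (permTuple σ v) I = rankMap v (I.image σ.symm) := by
  obtain ⟨x, hx⟩ := exists_rep v
  replace hx : Represents x v := hx
  exact rankMap_eq_of (hx.permTuple σ) hx (fun _ _ => Iff.rfl) (fun _ _ _ => Iff.rfl) I

/-! ### Combinatorics of the rank functions -/

/-- The list `phiList` as a finite set, so that statements about all its members are decidable. -/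
def phiFinset : Finset (Finset (Fin 4) → ℕ) :=
  {phi8, phi6, phi2} ∪ Finset.univ.image phi7 ∪ Finset.univ.image phi4s ∪
    (Finset.univ.filter fun p : Fin 4 × Fin 4 => p.1 < p.2).biUnion
      fun p => {phi6p p.1 p.2, phi5 p.1 p.2, phi4p p.1 p.2}

theorem mem_phiFinset {φ : Finset (Fin 4) → ℕ} : φ ∈ phiFinset ↔ φ ∈ phiList := by
  simp only [phiFinset, phiList, Finset.mem_union, Finset.mem_insert, Finset.mem_singleton,
    Finset.mem_image, Finset.mem_univ, true_and, Finset.mem_biUnion, Finset.mem_filter,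
    Prod.exists, Set.mem_ofPred_eq, eq_comm (b := φ)]
  constructor
  · rintro ((((h | h | h) | h) | h) | ⟨i, j, hij, h | h | h⟩)
    · exact Or.inl h
    · tauto
    · tauto
    · tauto
    · tauto
    · exact Or.inr (Or.inr (Or.inl ⟨i, j, hij, h⟩))
    · exact Or.inr (Or.inr (Or.inr (Or.inr (Or.inl ⟨i, j, hij, h⟩))))
    · exact Or.inr (Or.inr (Or.inr (Or.inr (Or.inr (Or.inl ⟨i, j, hij, h⟩)))))
  · rintro (h | h | ⟨i, j, hij, h⟩ | h | ⟨i, j, hij, h⟩ | ⟨i, j, hij, h⟩ | h | h)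
    all_goals first | tauto | exact Or.inr ⟨i, j, hij, by tauto⟩

/-- A function on subsets of `Fin 4` is determined, in the manner of a rank function of rank at
most `3`, by the pairs of rank `1` and by the triples of rank at most `2`. -/
structure IsTripleDetermined (φ : Finset (Fin 4) → ℕ) : Prop where
  le_card : ∀ I, φ I ≤ I.card
  one_le : ∀ I : Finset (Fin 4), I.Nonempty → 1 ≤ φ I
  le_three : ∀ I, φ I ≤ 3
  le_one_iff : ∀ I, φ I ≤ 1 ↔ ∀ J ⊆ I, J.card = 2 → φ J ≤ 1
  le_two_iff : ∀ I, φ I ≤ 2 ↔ ∀ J ⊆ I, J.card = 3 → φ J ≤ 2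

theorem isTripleDetermined_iff (φ : Finset (Fin 4) → ℕ) : IsTripleDetermined φ ↔
    (∀ I, φ I ≤ I.card) ∧ (∀ I : Finset (Fin 4), I.Nonempty → 1 ≤ φ I) ∧ (∀ I, φ I ≤ 3) ∧
      (∀ I, φ I ≤ 1 ↔ ∀ J ∈ I.powersetCard 2, φ J ≤ 1) ∧
      (∀ I, φ I ≤ 2 ↔ ∀ J ∈ I.powersetCard 3, φ J ≤ 2) := by
  simp only [Finset.mem_powersetCard, and_imp]
  exact ⟨fun h => ⟨h.1, h.2, h.3, h.4, h.5⟩, fun ⟨h1, h2, h3, h4, h5⟩ => ⟨h1, h2, h3, h4, h5⟩⟩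

theorem isTripleDetermined_of_mem {φ : Finset (Fin 4) → ℕ} (hφ : φ ∈ phiList) :
    IsTripleDetermined φ := by
  rw [isTripleDetermined_iff]
  rw [← mem_phiFinset] at hφ
  revert φ
  decide +kernel

theorem IsTripleDetermined.le {φ ψ : Finset (Fin 4) → ℕ} (hφ : IsTripleDetermined φ)
    (hψ : IsTripleDetermined ψ) (h2 : ∀ I, I.card = 2 → φ I ≤ 1 → ψ I ≤ 1)
    (h3 : ∀ I, I.card = 3 → φ I ≤ 2 → ψ I ≤ 2) : ψ ≤ φ := by
  intro I
  change ψ I ≤ φ I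
  have a1 : φ I ≤ 1 → ψ I ≤ 1 := fun h => (hψ.le_one_iff I).mpr fun J hJ hc =>
    h2 J hc ((hφ.le_one_iff I).mp h J hJ hc)
  have a2 : φ I ≤ 2 → ψ I ≤ 2 := fun h => (hψ.le_two_iff I).mpr fun J hJ hc =>
    h3 J hc ((hφ.le_two_iff I).mp h J hJ hc)
  have a3 := hψ.le_three I
  rcases I.eq_empty_or_nonempty with rfl | hI
  · exact (hψ.le_card ∅).trans (Nat.zero_le _)
  · have := hφ.one_le I hI
    omega

theorem forall_card_eq_two {P : Finset (Fin 4) → Prop} :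
    (∀ I, I.card = 2 → P I) ↔ P {0, 1} ∧ P {0, 2} ∧ P {0, 3} ∧ P {1, 2} ∧ P {1, 3} ∧ P {2, 3} := by
  constructor
  · intro h
    refine ⟨?_, ?_, ?_, ?_, ?_, ?_⟩ <;> exact h _ (by decide)
  · rintro ⟨h1, h2, h3, h4, h5, h6⟩ I hI
    have key : ∀ I : Finset (Fin 4), I.card = 2 → I = {0, 1} ∨ I = {0, 2} ∨ I = {0, 3} ∨
        I = {1, 2} ∨ I = {1, 3} ∨ I = {2, 3} := by decide +kernel
    rcases key I hI with rfl | rfl | rfl | rfl | rfl | rfl <;> assumption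

theorem forall_card_eq_three {P : Finset (Fin 4) → Prop} :
    (∀ I, I.card = 3 → P I) ↔ P {0, 1, 2} ∧ P {0, 1, 3} ∧ P {0, 2, 3} ∧ P {1, 2, 3} := by
  constructor
  · intro h
    refine ⟨?_, ?_, ?_, ?_⟩ <;> exact h _ (by decide)
  · rintro ⟨h1, h2, h3, h4⟩ I hI
    have key : ∀ I : Finset (Fin 4), I.card = 3 → I = {0, 1, 2} ∨ I = {0, 1, 3} ∨ I = {0, 2, 3} ∨
        I = {1, 2, 3} := by decide +kernel
    rcases key I hI with rfl | rfl | rfl | rfl <;> assumption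

section Classification

/-- The pairs of rank at most `1` of a function on subsets. -/
def pairBits (φ : Finset (Fin 4) → ℕ) : List Bool :=
  [φ {0, 1} ≤ 1, φ {0, 2} ≤ 1, φ {0, 3} ≤ 1, φ {1, 2} ≤ 1, φ {1, 3} ≤ 1, φ {2, 3} ≤ 1]

/-- The triples of rank at most `2` of a function on subsets. -/
def tripleBits (φ : Finset (Fin 4) → ℕ) : List Bool :=
  [φ {0, 1, 2} ≤ 2, φ {0, 1, 3} ≤ 2, φ {0, 2, 3} ≤ 2, φ {1, 2, 3} ≤ 2]

theorem IsTripleDetermined.eq_of_bits {φ ψ : Finset (Fin 4) → ℕ} (hφ : IsTripleDetermined φ)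
    (hψ : IsTripleDetermined ψ) (h2 : pairBits φ = pairBits ψ)
    (h3 : tripleBits φ = tripleBits ψ) : φ = ψ := by
  simp only [pairBits, tripleBits, List.cons.injEq, decide_eq_decide, and_true] at h2 h3
  have e2 : ∀ I : Finset (Fin 4), I.card = 2 → (φ I ≤ 1 ↔ ψ I ≤ 1) := forall_card_eq_two.mpr h2
  have e3 : ∀ I : Finset (Fin 4), I.card = 3 → (φ I ≤ 2 ↔ ψ I ≤ 2) := forall_card_eq_three.mpr h3
  exact le_antisymm (hψ.le hφ (fun I h => (e2 I h).2) fun I h => (e3 I h).2)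
    (hφ.le hψ (fun I h => (e2 I h).1) fun I h => (e3 I h).1)

set_option synthInstance.maxHeartbeats 200000 in
set_option synthInstance.maxSize 1000 in
/-- A combinatorial classification: the possible sets of rank-`1` pairs and of rank-`2` triples of
a loopless matroid on four elements of rank at most `3`. The hypotheses on the bits are
transitivity of parallelism, dependence of triples with a parallel pair, and the exchange property
of collinear triples. -/
theorem exists_bits (e01 e02 e03 e12 e13 e23 d012 d013 d023 d123 : Bool)
    (t : ((e01 && e12 → e02) ∧ (e01 && e02 → e12) ∧ (e02 && e12 → e01)) ∧
      ((e01 && e13 → e03) ∧ (e01 && e03 → e13) ∧ (e03 && e13 → e01)) ∧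
      ((e02 && e23 → e03) ∧ (e02 && e03 → e23) ∧ (e03 && e23 → e02)) ∧
      ((e12 && e23 → e13) ∧ (e12 && e13 → e23) ∧ (e13 && e23 → e12)))
    (p : (e01 || e02 || e12 → d012) ∧ (e01 || e03 || e13 → d013) ∧ (e02 || e03 || e23 → d023) ∧
      (e12 || e13 || e23 → d123))
    (x : (d012 && d013 && !e01 → d023 && d123) ∧ (d012 && d023 && !e02 → d013 && d123) ∧
      (d013 && d023 && !e03 → d012 && d123) ∧ (d012 && d123 && !e12 → d013 && d023) ∧
      (d013 && d123 && !e13 → d012 && d023) ∧ (d023 && d123 && !e23 → d012 && d013)) :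
    ∃ φ ∈ phiFinset, pairBits φ = [e01, e02, e03, e12, e13, e23] ∧
      tripleBits φ = [d012, d013, d023, d123] := by
  revert e01 e02 e03 e12 e13 e23 d012 d013 d023 d123
  decide +kernel

end Classification

section Diagram

instance (φ ψ : Finset (Fin 4) → ℕ) : Decidable (φ ≤ ψ) :=
  inferInstanceAs (Decidable (∀ I, φ I ≤ ψ I))

theorem reachable_phi2 {ψ : Finset (Fin 4) → ℕ} (hψ : ψ ∈ phiList) (h : ψ ≤ phi2) :
    Relation.ReflTransGen Edge (.fib phi2) (.fib ψ) := by
  have key : ∀ ψ ∈ phiFinset, ψ ≤ phi2 → ψ = phi2 := by decide +kernel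
  rw [key ψ (mem_phiFinset.mpr hψ) h]

theorem reachable_phi4s (i : Fin 4) {ψ : Finset (Fin 4) → ℕ} (hψ : ψ ∈ phiList)
    (h : ψ ≤ phi4s i) : Relation.ReflTransGen Edge (.fib (phi4s i)) (.fib ψ) := by
  have key : ∀ i, ∀ ψ ∈ phiFinset, ψ ≤ phi4s i → ψ = phi4s i ∨ ψ ≤ phi2 := by decide +kernel
  rcases key i ψ (mem_phiFinset.mpr hψ) h with rfl | h
  · exact .refl
  · exact .head (.e4s_2 i) (reachable_phi2 hψ h)

theorem reachable_phi4p {i j : Fin 4} (hij : i < j) {ψ : Finset (Fin 4) → ℕ} (hψ : ψ ∈ phiList)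
    (h : ψ ≤ phi4p i j) : Relation.ReflTransGen Edge (.fib (phi4p i j)) (.fib ψ) := by
  have key : ∀ i j, i < j → ∀ ψ ∈ phiFinset, ψ ≤ phi4p i j → ψ = phi4p i j ∨ ψ ≤ phi2 := by
    decide +kernel
  rcases key i j hij ψ (mem_phiFinset.mpr hψ) h with rfl | h
  · exact .refl
  · exact .head (.e4p_2 i j hij) (reachable_phi2 hψ h)

theorem reachable_phi5 {i j : Fin 4} (hij : i < j) {ψ : Finset (Fin 4) → ℕ} (hψ : ψ ∈ phiList)
    (h : ψ ≤ phi5 i j) : Relation.ReflTransGen Edge (.fib (phi5 i j)) (.fib ψ) := by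
  have key : ∀ i j, i < j → ∀ ψ ∈ phiFinset, ψ ≤ phi5 i j →
      ψ = phi5 i j ∨ ψ ≤ phi4p i j ∨ ∃ k, k ≠ i ∧ k ≠ j ∧ ψ ≤ phi4s k := by
    decide +kernel
  rcases key i j hij ψ (mem_phiFinset.mpr hψ) h with rfl | h | ⟨k, hki, hkj, h⟩
  · exact .refl
  · exact .head (.e5_4p i j hij) (reachable_phi4p hij hψ h)
  · exact .head (.e5_4s i j k hij hki hkj) (reachable_phi4s k hψ h)

theorem reachable_phi6 {ψ : Finset (Fin 4) → ℕ} (hψ : ψ ∈ phiList) (h : ψ ≤ phi6) :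
    Relation.ReflTransGen Edge (.fib phi6) (.fib ψ) := by
  have key : ∀ ψ ∈ phiFinset, ψ ≤ phi6 → ψ = phi6 ∨ ∃ i j, i < j ∧ ψ ≤ phi5 i j := by
    decide +kernel
  rcases key ψ (mem_phiFinset.mpr hψ) h with rfl | ⟨i, j, hij, h⟩
  · exact .refl
  · exact .head (.e6_5 i j hij) (reachable_phi5 hij hψ h)

theorem reachable_phi6p {i j : Fin 4} (hij : i < j) {ψ : Finset (Fin 4) → ℕ} (hψ : ψ ∈ phiList)
    (h : ψ ≤ phi6p i j) : Relation.ReflTransGen Edge (.fib (phi6p i j)) (.fib ψ) := by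
  have key : ∀ i j, i < j → ∀ ψ ∈ phiFinset, ψ ≤ phi6p i j →
      ψ = phi6p i j ∨ ψ ≤ phi5 i j := by
    decide +kernel
  rcases key i j hij ψ (mem_phiFinset.mpr hψ) h with rfl | h
  · exact .refl
  · exact .head (.e6p_5 i j hij) (reachable_phi5 hij hψ h)

theorem reachable_phi7 (i : Fin 4) {ψ : Finset (Fin 4) → ℕ} (hψ : ψ ∈ phiList)
    (h : ψ ≤ phi7 i) : Relation.ReflTransGen Edge (.fib (phi7 i)) (.fib ψ) := by
  have key : ∀ i, ∀ ψ ∈ phiFinset, ψ ≤ phi7 i →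
      ψ = phi7 i ∨ ψ ≤ phi6 ∨ ∃ j k, i ≠ j ∧ i ≠ k ∧ j < k ∧ ψ ≤ phi6p j k := by
    decide +kernel
  rcases key i ψ (mem_phiFinset.mpr hψ) h with rfl | h | ⟨j, k, hij, hik, hjk, h⟩
  · exact .refl
  · exact .head (.e7_6 i) (reachable_phi6 hψ h)
  · exact .head (.e7_6p i j k hij hik hjk) (reachable_phi6p hjk hψ h)

theorem reachable_phi8 {ψ : Finset (Fin 4) → ℕ} (hψ : ψ ∈ phiList) :
    Relation.ReflTransGen Edge (.fib phi8) (.fib ψ) := by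
  have key : ∀ ψ ∈ phiFinset, ψ = phi8 ∨ ∃ i, ψ ≤ phi7 i := by
    decide +kernel
  rcases key ψ (mem_phiFinset.mpr hψ) with rfl | ⟨i, h⟩
  · exact .refl
  · exact .head (.e8_7 i) (reachable_phi7 i hψ h)

/-- The diagram, without the vertex `O(5;p)`, contains the Hasse diagram of the order `≤`. -/
theorem reachable_of_le {φ ψ : Finset (Fin 4) → ℕ} (hφ : φ ∈ phiList) (hψ : ψ ∈ phiList)
    (h : ψ ≤ φ) : Relation.ReflTransGen Edge (.fib φ) (.fib ψ) := by
  rcases hφ with rfl | ⟨i, rfl⟩ | ⟨i, j, hij, rfl⟩ | rfl | ⟨i, j, hij, rfl⟩ | ⟨i, j, hij, rfl⟩ |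
    ⟨i, rfl⟩ | rfl
  · exact reachable_phi8 hψ
  · exact reachable_phi7 i hψ h
  · exact reachable_phi6p hij hψ h
  · exact reachable_phi6 hψ h
  · exact reachable_phi5 hij hψ h
  · exact reachable_phi4p hij hψ h
  · exact reachable_phi4s i hψ h
  · exact reachable_phi2 hψ h

end Diagram

/-! ### The image of the rank map -/

theorem rankMap_mono {m : ℕ} (v : MultiProj K 3 m) {I J : Finset (Fin m)} (h : I ⊆ J) :
    rankMap v I ≤ rankMap v J :=
  Submodule.finrank_mono (biSup_mono fun _ hi => h hi)

theorem rankMap_submodular {m : ℕ} (v : MultiProj K 3 m) (I J : Finset (Fin m)) :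
    rankMap v (I ∪ J) + rankMap v (I ∩ J) ≤ rankMap v I + rankMap v J := by
  unfold rankMap
  rw [← Submodule.finrank_sup_add_finrank_inf_eq (⨆ i ∈ I, (v i).submodule)]
  refine add_le_add (Submodule.finrank_mono ?_) (Submodule.finrank_mono ?_)
  · refine iSup₂_le fun i hi => ?_
    rcases Finset.mem_union.mp hi with h | h
    · exact le_sup_of_le_left (le_iSup₂_of_le i h le_rfl)
    · exact le_sup_of_le_right (le_iSup₂_of_le i h le_rfl)
  · refine iSup₂_le fun i hi => le_inf ?_ ?_
    · exact le_iSup₂_of_le i (Finset.mem_inter.mp hi).1 le_rfl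
    · exact le_iSup₂_of_le i (Finset.mem_inter.mp hi).2 le_rfl

theorem rankMap_le_card {m : ℕ} (v : MultiProj K 3 m) (I : Finset (Fin m)) :
    rankMap v I ≤ I.card := by
  classical
  obtain ⟨x, hx⟩ := exists_rep v
  replace hx : Represents x v := hx
  unfold rankMap
  rw [hx.iSup_eq_span, ← Finset.coe_image]
  exact (finrank_span_finset_le_card _).trans Finset.card_image_le

theorem rankMap_pair_le_one {m : ℕ} (v : MultiProj K 3 m) (i j : Fin m) :
    rankMap v {i, j} ≤ 1 ↔ v i = v j := by
  rw [rankMap_le_one_iff]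
  constructor
  · intro h
    exact h i (by simp) j (by simp)
  · intro h a ha b hb
    simp only [Finset.mem_insert, Finset.mem_singleton] at ha hb
    rcases ha with rfl | rfl <;> rcases hb with rfl | rfl <;> simp [h]

theorem Represents.rankMap_triple_le_two {m : ℕ} {x : Fin m → Fin 3 → K} {v : MultiProj K 3 m}
    (hx : Represents x v) (i j k : Fin m) :
    rankMap v {i, j, k} ≤ 2 ↔ det3 (x i) (x j) (x k) = 0 := by
  rw [hx.rankMap_le_two_iff]
  constructor
  · intro h
    exact h i (by simp) j (by simp) k (by simp)
  · intro h a ha b hb c hc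
    simp only [det3_eq] at h ⊢
    simp only [Finset.mem_insert, Finset.mem_singleton] at ha hb hc
    rcases ha with rfl | rfl | rfl <;> rcases hb with rfl | rfl | rfl <;>
      rcases hc with rfl | rfl | rfl <;>
      first
        | ring1
        | linear_combination h
        | linear_combination -h

theorem isTripleDetermined_rankMap (v : MultiProj K 3 4) : IsTripleDetermined (rankMap v) where
  le_card := rankMap_le_card v
  one_le _ := one_le_rankMap v
  le_three := rankMap_le_three v
  le_one_iff I := by
    refine ⟨fun h J hJ _ => (rankMap_mono v hJ).trans h, fun h => ?_⟩
    rw [rankMap_le_one_iff]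
    intro i hi j hj
    by_cases hij : i = j
    · rw [hij]
    · exact (rankMap_pair_le_one v i j).mp (h {i, j} (by simp [Finset.insert_subset_iff, hi, hj])
        (Finset.card_pair hij))
  le_two_iff I := by
    refine ⟨fun h J hJ _ => (rankMap_mono v hJ).trans h, fun h => ?_⟩
    obtain ⟨x, hx⟩ := exists_rep v
    replace hx : Represents x v := hx
    rw [hx.rankMap_le_two_iff]
    intro i hi j hj k hk
    by_cases hij : i = j
    · rw [hij, det3_eq]; ring
    by_cases hik : i = k
    · rw [hik, det3_eq]; ring
    by_cases hjk : j = k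
    · rw [hjk, det3_eq]; ring
    · exact (hx.rankMap_triple_le_two i j k).mp
        (h {i, j, k} (by simp [Finset.insert_subset_iff, hi, hj, hk])
        (Finset.card_eq_three.mpr ⟨i, j, k, hij, hik, hjk, rfl⟩))

theorem rankMap_mem_phiList (v : MultiProj K 3 4) : rankMap v ∈ phiList := by
  have hv := isTripleDetermined_rankMap v
  have c : ∀ I, rankMap v I ≤ I.card := hv.le_card
  have s : ∀ {I J U N : Finset (Fin 4)}, I ∪ J = U → I ∩ J = N →
      rankMap v U + rankMap v N ≤ rankMap v I + rankMap v J := by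
    rintro I J _ _ rfl rfl
    exact rankMap_submodular v I J
  have m : ∀ {I J : Finset (Fin 4)}, I ⊆ J → rankMap v I ≤ rankMap v J := rankMap_mono v
  have one : ∀ i : Fin 4, 1 ≤ rankMap v {i} := fun i => hv.one_le _ ⟨i, by simp⟩
  generalize hr : rankMap v = r at *
  have c01 : r {0, 1} ≤ 2 := c {0, 1}
  have c02 : r {0, 2} ≤ 2 := c {0, 2}
  have c03 : r {0, 3} ≤ 2 := c {0, 3}
  have c12 : r {1, 2} ≤ 2 := c {1, 2}
  have c13 : r {1, 3} ≤ 2 := c {1, 3}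
  have c23 : r {2, 3} ≤ 2 := c {2, 3}
  have o0 := one 0
  have o1 := one 1
  have o2 := one 2
  have o3 := one 3
  have m1 : r {0, 1} ≤ r {0, 1, 2} := m (by decide)
  have m2 : r {0, 2} ≤ r {0, 1, 2} := m (by decide)
  have m3 : r {1, 2} ≤ r {0, 1, 2} := m (by decide)
  have m4 : r {0, 1} ≤ r {0, 1, 3} := m (by decide)
  have m5 : r {0, 3} ≤ r {0, 1, 3} := m (by decide)
  have m6 : r {1, 3} ≤ r {0, 1, 3} := m (by decide)
  have m7 : r {0, 2} ≤ r {0, 2, 3} := m (by decide)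
  have m8 : r {0, 3} ≤ r {0, 2, 3} := m (by decide)
  have m9 : r {2, 3} ≤ r {0, 2, 3} := m (by decide)
  have m10 : r {1, 2} ≤ r {1, 2, 3} := m (by decide)
  have m11 : r {1, 3} ≤ r {1, 2, 3} := m (by decide)
  have m12 : r {2, 3} ≤ r {1, 2, 3} := m (by decide)
  have u1 : r {0, 1, 2} ≤ r Finset.univ := m (by decide)
  have u2 : r {0, 1, 3} ≤ r Finset.univ := m (by decide)
  have u3 : r {0, 2, 3} ≤ r Finset.univ := m (by decide)
  have u4 : r {1, 2, 3} ≤ r Finset.univ := m (by decide)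
  have s1 : r {0, 1, 2} + r {1} ≤ r {0, 1} + r {1, 2} := s (by decide) (by decide)
  have s2 : r {0, 1, 2} + r {0} ≤ r {0, 1} + r {0, 2} := s (by decide) (by decide)
  have s3 : r {0, 1, 2} + r {2} ≤ r {0, 2} + r {1, 2} := s (by decide) (by decide)
  have s4 : r {0, 1, 3} + r {1} ≤ r {0, 1} + r {1, 3} := s (by decide) (by decide)
  have s5 : r {0, 1, 3} + r {0} ≤ r {0, 1} + r {0, 3} := s (by decide) (by decide)
  have s6 : r {0, 1, 3} + r {3} ≤ r {0, 3} + r {1, 3} := s (by decide) (by decide)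
  have s7 : r {0, 2, 3} + r {2} ≤ r {0, 2} + r {2, 3} := s (by decide) (by decide)
  have s8 : r {0, 2, 3} + r {0} ≤ r {0, 2} + r {0, 3} := s (by decide) (by decide)
  have s9 : r {0, 2, 3} + r {3} ≤ r {0, 3} + r {2, 3} := s (by decide) (by decide)
  have s10 : r {1, 2, 3} + r {2} ≤ r {1, 2} + r {2, 3} := s (by decide) (by decide)
  have s11 : r {1, 2, 3} + r {1} ≤ r {1, 2} + r {1, 3} := s (by decide) (by decide)
  have s12 : r {1, 2, 3} + r {3} ≤ r {1, 3} + r {2, 3} := s (by decide) (by decide)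
  have t1 : r Finset.univ + r {0, 1} ≤ r {0, 1, 2} + r {0, 1, 3} := s (by decide) (by decide)
  have t2 : r Finset.univ + r {0, 2} ≤ r {0, 1, 2} + r {0, 2, 3} := s (by decide) (by decide)
  have t3 : r Finset.univ + r {0, 3} ≤ r {0, 1, 3} + r {0, 2, 3} := s (by decide) (by decide)
  have t4 : r Finset.univ + r {1, 2} ≤ r {0, 1, 2} + r {1, 2, 3} := s (by decide) (by decide)
  have t5 : r Finset.univ + r {1, 3} ≤ r {0, 1, 3} + r {1, 2, 3} := s (by decide) (by decide)
  have t6 : r Finset.univ + r {2, 3} ≤ r {0, 2, 3} + r {1, 2, 3} := s (by decide) (by decide)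
  obtain ⟨φ, hφ, h2, h3⟩ := exists_bits (r {0, 1} ≤ 1) (r {0, 2} ≤ 1) (r {0, 3} ≤ 1)
    (r {1, 2} ≤ 1) (r {1, 3} ≤ 1) (r {2, 3} ≤ 1) (r {0, 1, 2} ≤ 2) (r {0, 1, 3} ≤ 2)
    (r {0, 2, 3} ≤ 2) (r {1, 2, 3} ≤ 2)
    (by simp only [Bool.and_eq_true, decide_eq_true_eq]; clear c s m one; omega)
    (by simp only [Bool.or_eq_true, decide_eq_true_eq]; clear c s m one; omega)
    (by
      simp only [Bool.and_eq_true, Bool.not_eq_true', decide_eq_true_eq, decide_eq_false_iff_not]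
      clear c s m one; omega)
  rw [mem_phiFinset] at hφ
  rwa [hv.eq_of_bits (isTripleDetermined_of_mem hφ) h2.symm h3.symm]

theorem mem_phiList_of_mem_fibre {φ : Finset (Fin 4) → ℕ} {v : MultiProj K 3 4}
    (hv : v ∈ fibre K φ) : φ ∈ phiList := by
  have : rankMap v = φ := hv
  rw [← this]
  exact rankMap_mem_phiList v

/-- Membership in a fibre, expressed by the vanishing of minors. -/
theorem Represents.mem_fibre_iff {x : Fin 4 → Fin 3 → K} {v : MultiProj K 3 4}
    (hx : Represents x v) {φ : Finset (Fin 4) → ℕ} (hφ : φ ∈ phiList) :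
    v ∈ fibre K φ ↔
      ((v 0 = v 1 ↔ φ {0, 1} ≤ 1) ∧ (v 0 = v 2 ↔ φ {0, 2} ≤ 1) ∧ (v 0 = v 3 ↔ φ {0, 3} ≤ 1) ∧
        (v 1 = v 2 ↔ φ {1, 2} ≤ 1) ∧ (v 1 = v 3 ↔ φ {1, 3} ≤ 1) ∧ (v 2 = v 3 ↔ φ {2, 3} ≤ 1)) ∧
      ((det3 (x 0) (x 1) (x 2) = 0 ↔ φ {0, 1, 2} ≤ 2) ∧
        (det3 (x 0) (x 1) (x 3) = 0 ↔ φ {0, 1, 3} ≤ 2) ∧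
        (det3 (x 0) (x 2) (x 3) = 0 ↔ φ {0, 2, 3} ≤ 2) ∧
        (det3 (x 1) (x 2) (x 3) = 0 ↔ φ {1, 2, 3} ≤ 2)) := by
  simp only [← rankMap_pair_le_one, ← hx.rankMap_triple_le_two]
  constructor
  · intro h
    have h : rankMap v = φ := h
    simp [h]
  · rintro ⟨h2, h3⟩
    refine (isTripleDetermined_rankMap v).eq_of_bits (isTripleDetermined_of_mem hφ) ?_ ?_
    · simpa only [pairBits, List.cons.injEq, decide_eq_decide, and_true] using h2
    · simpa only [tripleBits, List.cons.injEq, decide_eq_decide, and_true] using h3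

/-- The condition `rankMap v ≤ φ`, expressed by the vanishing of minors. -/
theorem Represents.rankMap_le_iff {x : Fin 4 → Fin 3 → K} {v : MultiProj K 3 4}
    (hx : Represents x v) {φ : Finset (Fin 4) → ℕ} (hφ : φ ∈ phiList) :
    rankMap v ≤ φ ↔ (∀ i j, φ {i, j} ≤ 1 → ∀ a b, x i a * x j b - x i b * x j a = 0) ∧
      ∀ i j k, φ {i, j, k} ≤ 2 → det3 (x i) (x j) (x k) = 0 := by
  simp only [sub_eq_zero, ← hx.eq_iff_minors, ← rankMap_pair_le_one, ← hx.rankMap_triple_le_two]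
  constructor
  · intro h
    exact ⟨fun i j => (h _).trans, fun i j k => (h _).trans⟩
  · rintro ⟨h2, h3⟩
    refine (isTripleDetermined_of_mem hφ).le (isTripleDetermined_rankMap v) ?_ ?_
    · intro I hI
      obtain ⟨i, j, -, rfl⟩ := Finset.card_eq_two.mp hI
      exact h2 i j
    · intro I hI
      obtain ⟨i, j, k, -, -, -, rfl⟩ := Finset.card_eq_three.mp hI
      exact h3 i j k

/-! ### The fibres as orbits -/

theorem smul_mem_fibre {φ : Finset (Fin 4) → ℕ} {v : MultiProj K 3 4} (hv : v ∈ fibre K φ)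
    (g : GL (Fin 3) K) : g • v ∈ fibre K φ := by
  change rankMap (g • v) = φ
  rw [rankMap_smul]
  exact hv

/-- The matrix with columns `b 0`, `b 1`, `b 2` moves `w` to `v` if it maps representatives of `w`
to multiples of representatives of `v`. The map `τ` allows the use of the representative of one
among several equal points of `v`. -/
theorem Represents.mem_diagOrbit {x y : Fin 4 → Fin 3 → K} {v w : MultiProj K 3 4}
    (hx : Represents x v) (hy : Represents y w) {b : Fin 3 → Fin 3 → K}
    (hb : det3 (b 0) (b 1) (b 2) ≠ 0) (c : Fin 4 → K) (hc : ∀ i, c i ≠ 0)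
    (τ : Fin 4 → Fin 4) (hτ : ∀ i, v (τ i) = v i)
    (h : ∀ i, y i 0 • b 0 + y i 1 • b 1 + y i 2 • b 2 = c i • x (τ i)) : v ∈ diagOrbit w := by
  have hdet : (Matrix.of b).transpose.det ≠ 0 := by
    rw [Matrix.det_transpose]
    have : b = ![b 0, b 1, b 2] := by ext i; fin_cases i <;> rfl
    rw [this]
    exact hb
  refine ⟨Matrix.GeneralLinearGroup.mkOfDetNeZero _ hdet, ?_⟩
  have hx' : Represents (fun i => x (τ i)) v := fun i => by
    rw [← hτ i]
    exact hx (τ i)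
  refine (hy.smul _).congr (hx'.scale c hc fun i => ?_)
  rw [← h i]
  change (Matrix.of b).transpose.mulVec (y i) = _
  ext k
  simp [Matrix.mulVec, dotProduct, Fin.sum_univ_three, mul_comm]

/-- Cramer's rule. -/
theorem exists_coords {x y z : Fin 3 → K} (h : det3 x y z ≠ 0) (w : Fin 3 → K) :
    ∃ a b c : K, w = a • x + b • y + c • z ∧ a * det3 x y z = det3 w y z ∧
      b * det3 x y z = det3 x w z ∧ c * det3 x y z = det3 x y w := by
  refine ⟨det3 w y z / det3 x y z, det3 x w z / det3 x y z, det3 x y w / det3 x y z, ?_,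
    div_mul_cancel₀ _ h, div_mul_cancel₀ _ h, div_mul_cancel₀ _ h⟩
  ext k
  simp only [Pi.add_apply, Pi.smul_apply, smul_eq_mul]
  field_simp
  simp only [det3_eq]
  fin_cases k <;> simp only [Fin.zero_eta, Fin.mk_one, Fin.reduceFinMk] <;> ring

/-- A point on the line through two distinct points is a combination of these. -/
theorem exists_comb {x y w : Fin 3 → K} (h : ¬ ∀ a b, x a * y b = x b * y a)
    (hw : det3 x y w = 0) : ∃ a b : K, w = a • x + b • y := by
  obtain ⟨z, hz⟩ := exists_det3_ne_zero h
  obtain ⟨a, b, c, e, -, -, h0⟩ := exists_coords hz w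
  rw [hw, mul_eq_zero, or_iff_left hz] at h0
  exact ⟨a, b, by rw [e, h0]; simp⟩

theorem fibre_eq_diagOrbit {φ : Finset (Fin 4) → ℕ} {w : MultiProj K 3 4} (hw : w ∈ fibre K φ)
    (h : ∀ v ∈ fibre K φ, v ∈ diagOrbit w) : fibre K φ = diagOrbit w := by
  refine Set.Subset.antisymm h ?_
  rintro _ ⟨g, rfl⟩
  exact smul_mem_fibre hw g

theorem permTuple_mem_fibre {φ φ' : Finset (Fin 4) → ℕ} {σ : Equiv.Perm (Fin 4)}
    (h : ∀ I, φ' (I.image σ) = φ I) (v : MultiProj K 3 4) :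
    permTuple σ v ∈ fibre K φ' ↔ v ∈ fibre K φ := by
  change rankMap _ = φ' ↔ rankMap v = φ
  constructor
  · intro e
    funext I
    rw [← h, ← e, rankMap_permTuple, Finset.image_image]
    simp
  · intro e
    funext I
    rw [rankMap_permTuple, e, ← h, Finset.image_image]
    simp

theorem permTuple_surjective (σ : Equiv.Perm (Fin 4)) :
    Function.Surjective (permTuple (K := K) σ) := fun v =>
  ⟨fun i => v (σ i), funext fun i => congrArg v (σ.apply_symm_apply i)⟩

theorem fibre_eq_diagOrbit_permTuple {φ φ' : Finset (Fin 4) → ℕ} {w : MultiProj K 3 4}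
    (hw : fibre K φ = diagOrbit w) {σ : Equiv.Perm (Fin 4)} (h : ∀ I, φ' (I.image σ) = φ I) :
    fibre K φ' = diagOrbit (permTuple σ w) := by
  refine fibre_eq_diagOrbit ?_ fun v hv => ?_
  · rw [permTuple_mem_fibre h, hw]
    exact MulAction.mem_orbit_self w
  · obtain ⟨u, rfl⟩ := permTuple_surjective σ v
    rw [permTuple_mem_fibre h, hw] at hv
    obtain ⟨g, rfl⟩ := hv
    exact ⟨g, rfl⟩

theorem phi2_mem : phi2 ∈ phiList := mem_phiFinset.mp (by decide +kernel)

theorem phi6_mem : phi6 ∈ phiList := mem_phiFinset.mp (by decide +kernel)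

theorem phi8_mem : phi8 ∈ phiList := mem_phiFinset.mp (by decide +kernel)

theorem phi4s_mem (i : Fin 4) : phi4s i ∈ phiList := mem_phiFinset.mp (by revert i; decide +kernel)

theorem phi7_mem (i : Fin 4) : phi7 i ∈ phiList := mem_phiFinset.mp (by revert i; decide +kernel)

theorem phi4p_mem {i j : Fin 4} (h : i ≠ j) : phi4p i j ∈ phiList :=
  mem_phiFinset.mp (by revert i j; decide +kernel)

theorem phi5_mem {i j : Fin 4} (h : i ≠ j) : phi5 i j ∈ phiList :=
  mem_phiFinset.mp (by revert i j; decide +kernel)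

theorem phi6p_mem {i j : Fin 4} (h : i ≠ j) : phi6p i j ∈ phiList :=
  mem_phiFinset.mp (by revert i j; decide +kernel)

/-- A nonzero vector extends to a basis of `K³`. -/
theorem exists_det3_ne_zero_of_ne_zero {x : Fin 3 → K} (h : x ≠ 0) : ∃ y z, det3 x y z ≠ 0 := by
  suffices ∃ y : Fin 3 → K, ¬ ∀ a b, x a * y b = x b * y a by
    obtain ⟨y, hy⟩ := this
    exact ⟨y, exists_det3_ne_zero hy⟩
  contrapose! h
  funext k
  obtain ⟨l, hl⟩ := exists_ne k
  simpa [hl.symm, hl] using h (Pi.single l 1) k l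

theorem det3_smul_smul_smul (a b c : K) (x y z : Fin 3 → K) :
    det3 (a • x) (b • y) (c • z) = a * b * c * det3 x y z := by
  simp only [det3_eq, Pi.smul_apply, smul_eq_mul]
  ring

theorem Represents.not_minors {n m : ℕ} {x : Fin m → Fin n → K} {v : MultiProj K n m}
    (hx : Represents x v) {i j : Fin m} (h : v i ≠ v j) :
    ¬ ∀ a b, x i a * x j b = x i b * x j a := by
  rwa [← hx.eq_iff_minors]

theorem Represents.eq_of_eq_smul {n m : ℕ} {x : Fin m → Fin n → K} {v : MultiProj K n m}
    (hx : Represents x v) {i j : Fin m} {c : K} (h : x i = c • x j) : v i = v j := by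
  rw [hx.eq_iff_minors, h]
  intro a b
  simp only [Pi.smul_apply, smul_eq_mul]
  ring

theorem fibre_phi2 : fibre K phi2 = diagOrbit (rep2 K) := by
  have hy : Represents _ (rep2 K) := represents_tuple _ _
  refine fibre_eq_diagOrbit ?_ fun v hv => ?_
  · rw [hy.mem_fibre_iff phi2_mem]
    simp only [hy.eq_iff_minors]
    simp +decide [Fin.forall_fin_succ, det3_eq]
  · obtain ⟨x, hx⟩ := exists_rep v
    replace hx : Represents x v := hx
    rw [hx.mem_fibre_iff phi2_mem] at hv
    simp +decide only [iff_true] at hv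
    obtain ⟨⟨h01, h02, h03, -⟩, -⟩ := hv
    obtain ⟨y, z, h⟩ := exists_det3_ne_zero_of_ne_zero (hx.ne_zero 0)
    exact hx.mem_diagOrbit hy (b := ![x 0, y, z]) h (fun _ => 1) (fun _ => one_ne_zero) ![0, 0, 0, 0]
      (fun i => by fin_cases i <;> simp [← h01, ← h02, ← h03])
      (fun i => by fin_cases i <;> simp)
theorem fibre_phi4s_zero : fibre K (phi4s 0) = diagOrbit (rep4s K) := by
  have hy : Represents _ (rep4s K) := represents_tuple _ _
  refine fibre_eq_diagOrbit ?_ fun v hv => ?_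
  · rw [hy.mem_fibre_iff (phi4s_mem 0)]
    simp only [hy.eq_iff_minors]
    simp +decide [Fin.forall_fin_succ, det3_eq]
  · obtain ⟨x, hx⟩ := exists_rep v
    replace hx : Represents x v := hx
    rw [hx.mem_fibre_iff (phi4s_mem 0)] at hv
    simp +decide only [iff_true, iff_false] at hv
    obtain ⟨⟨h01, -, -, h12, h13, -⟩, -⟩ := hv
    obtain ⟨z, h⟩ := exists_det3_ne_zero (hx.not_minors h01)
    exact hx.mem_diagOrbit hy (b := ![x 0, x 1, z]) h (fun _ => 1) (fun _ => one_ne_zero) ![0, 1, 1, 1]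
      (fun i => by fin_cases i <;> simp [← h12, ← h13])
      (fun i => by fin_cases i <;> simp)
theorem fibre_phi4p_zero_one : fibre K (phi4p 0 1) = diagOrbit (rep4p K) := by
  have hy : Represents _ (rep4p K) := represents_tuple _ _
  refine fibre_eq_diagOrbit ?_ fun v hv => ?_
  · rw [hy.mem_fibre_iff (phi4p_mem zero_ne_one)]
    simp only [hy.eq_iff_minors]
    simp +decide [Fin.forall_fin_succ, det3_eq]
  · obtain ⟨x, hx⟩ := exists_rep v
    replace hx : Represents x v := hx
    rw [hx.mem_fibre_iff (phi4p_mem zero_ne_one)] at hv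
    simp +decide only [iff_true, iff_false] at hv
    obtain ⟨⟨h01, h02, -, -, -, h23⟩, -⟩ := hv
    obtain ⟨z, h⟩ := exists_det3_ne_zero (hx.not_minors h02)
    exact hx.mem_diagOrbit hy (b := ![x 0, x 2, z]) h (fun _ => 1) (fun _ => one_ne_zero) ![0, 0, 2, 2]
      (fun i => by fin_cases i <;> simp [← h01, ← h23])
      (fun i => by fin_cases i <;> simp)
theorem fibre_phi5_zero_one : fibre K (phi5 0 1) = diagOrbit (rep5 K) := by
  have hy : Represents _ (rep5 K) := represents_tuple _ _
  refine fibre_eq_diagOrbit ?_ fun v hv => ?_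
  · rw [hy.mem_fibre_iff (phi5_mem zero_ne_one)]
    simp only [hy.eq_iff_minors]
    simp +decide [Fin.forall_fin_succ, det3_eq]
  · obtain ⟨x, hx⟩ := exists_rep v
    replace hx : Represents x v := hx
    rw [hx.mem_fibre_iff (phi5_mem zero_ne_one)] at hv
    simp +decide only [iff_true, iff_false] at hv
    obtain ⟨⟨h01, h02, h03, -, -, h23⟩, -, -, h023, -⟩ := hv
    obtain ⟨z, h⟩ := exists_det3_ne_zero (hx.not_minors h02)
    obtain ⟨α, β, e⟩ := exists_comb (hx.not_minors h02) h023
    have hα : α ≠ 0 := by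
      rintro rfl
      exact h23 (hx.eq_of_eq_smul (c := β) (by simpa using e)).symm
    have hβ : β ≠ 0 := by
      rintro rfl
      exact h03 (hx.eq_of_eq_smul (c := α) (by simpa using e)).symm
    have hb : det3 (α • x 0) (β • x 2) ((1 : K) • z) ≠ 0 := by
      rw [det3_smul_smul_smul]
      simp [*]
    exact hx.mem_diagOrbit hy (b := ![α • x 0, β • x 2, (1 : K) • z]) hb ![α, α, β, 1]
      (fun i => by fin_cases i <;> simp [*]) ![0, 0, 2, 3]
      (fun i => by fin_cases i <;> simp [*])
      (fun i => by fin_cases i <;> simp [e])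
theorem fibre_phi6p_two_three : fibre K (phi6p 2 3) = diagOrbit (rep6p K) := by
  have hy : Represents _ (rep6p K) := represents_tuple _ _
  refine fibre_eq_diagOrbit ?_ fun v hv => ?_
  · rw [hy.mem_fibre_iff (phi6p_mem (by decide))]
    simp only [hy.eq_iff_minors]
    simp +decide [Fin.forall_fin_succ, det3_eq]
  · obtain ⟨x, hx⟩ := exists_rep v
    replace hx : Represents x v := hx
    rw [hx.mem_fibre_iff (phi6p_mem (by decide))] at hv
    simp +decide only [iff_true, iff_false] at hv
    obtain ⟨⟨-, -, -, -, -, h23⟩, h, -⟩ := hv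
    exact hx.mem_diagOrbit hy (b := ![x 0, x 1, x 2]) h (fun _ => 1) (fun _ => one_ne_zero) ![0, 1, 2, 2]
      (fun i => by fin_cases i <;> simp [← h23])
      (fun i => by fin_cases i <;> simp)
theorem fibre_phi7_zero : fibre K (phi7 0) = diagOrbit (rep7 K) := by
  have hy : Represents _ (rep7 K) := represents_tuple _ _
  refine fibre_eq_diagOrbit ?_ fun v hv => ?_
  · rw [hy.mem_fibre_iff (phi7_mem 0)]
    simp only [hy.eq_iff_minors]
    simp +decide [Fin.forall_fin_succ, det3_eq]
  · obtain ⟨x, hx⟩ := exists_rep v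
    replace hx : Represents x v := hx
    rw [hx.mem_fibre_iff (phi7_mem 0)] at hv
    simp +decide only [iff_true, iff_false] at hv
    obtain ⟨⟨-, -, -, h12, h13, h23⟩, h, -, -, h123⟩ := hv
    obtain ⟨β, γ, e⟩ := exists_comb (hx.not_minors h12) h123
    have hβ : β ≠ 0 := by
      rintro rfl
      exact h23 (hx.eq_of_eq_smul (c := γ) (by simpa using e)).symm
    have hγ : γ ≠ 0 := by
      rintro rfl
      exact h13 (hx.eq_of_eq_smul (c := β) (by simpa using e)).symm
    have hb : det3 ((1 : K) • x 0) (β • x 1) (γ • x 2) ≠ 0 := by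
      rw [det3_smul_smul_smul]
      simp [*]
    exact hx.mem_diagOrbit hy (b := ![(1 : K) • x 0, β • x 1, γ • x 2]) hb ![1, β, γ, 1]
      (fun i => by fin_cases i <;> simp [*]) ![0, 1, 2, 3]
      (fun i => by fin_cases i <;> rfl)
      (fun i => by fin_cases i <;> simp [e])
theorem fibre_phi8 : fibre K phi8 = diagOrbit (rep8 K) := by
  have hy : Represents _ (rep8 K) := represents_tuple _ _
  refine fibre_eq_diagOrbit ?_ fun v hv => ?_
  · rw [hy.mem_fibre_iff phi8_mem]
    simp only [hy.eq_iff_minors]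
    simp +decide [Fin.forall_fin_succ, det3_eq]
  · obtain ⟨x, hx⟩ := exists_rep v
    replace hx : Represents x v := hx
    rw [hx.mem_fibre_iff phi8_mem] at hv
    simp +decide only [iff_false] at hv
    obtain ⟨-, h, h013, h023, h123⟩ := hv
    obtain ⟨α, β, γ, e, hα, hβ, hγ⟩ := exists_coords h (x 3)
    have hα : α ≠ 0 := by
      rintro rfl
      apply h123
      simp only [det3_eq] at hα ⊢
      linear_combination -hα
    have hβ : β ≠ 0 := by
      rintro rfl
      apply h023
      simp only [det3_eq] at hβ ⊢
      linear_combination hβ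
    have hγ : γ ≠ 0 := by
      rintro rfl
      apply h013
      rw [← hγ, zero_mul]
    have hb : det3 (α • x 0) (β • x 1) (γ • x 2) ≠ 0 := by
      rw [det3_smul_smul_smul]
      simp [*]
    exact hx.mem_diagOrbit hy (b := ![α • x 0, β • x 1, γ • x 2]) hb ![α, β, γ, 1]
      (fun i => by fin_cases i <;> simp [*]) ![0, 1, 2, 3]
      (fun i => by fin_cases i <;> rfl)
      (fun i => by fin_cases i <;> simp [e])

theorem fibre_phi4s (σ : Equiv.Perm (Fin 4)) :
    fibre K (phi4s (σ 0)) = diagOrbit (permTuple σ (rep4s K)) :=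
  fibre_eq_diagOrbit_permTuple fibre_phi4s_zero (by revert σ; decide +kernel)

theorem fibre_phi4p (σ : Equiv.Perm (Fin 4)) :
    fibre K (phi4p (σ 0) (σ 1)) = diagOrbit (permTuple σ (rep4p K)) :=
  fibre_eq_diagOrbit_permTuple fibre_phi4p_zero_one (by revert σ; decide +kernel)

theorem fibre_phi5 (σ : Equiv.Perm (Fin 4)) :
    fibre K (phi5 (σ 0) (σ 1)) = diagOrbit (permTuple σ (rep5 K)) :=
  fibre_eq_diagOrbit_permTuple fibre_phi5_zero_one (by revert σ; decide +kernel)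

theorem fibre_phi6p (σ : Equiv.Perm (Fin 4)) :
    fibre K (phi6p (σ 2) (σ 3)) = diagOrbit (permTuple σ (rep6p K)) :=
  fibre_eq_diagOrbit_permTuple fibre_phi6p_two_three (by revert σ; decide +kernel)

theorem fibre_phi7 (σ : Equiv.Perm (Fin 4)) :
    fibre K (phi7 (σ 0)) = diagOrbit (permTuple σ (rep7 K)) :=
  fibre_eq_diagOrbit_permTuple fibre_phi7_zero (by revert σ; decide +kernel)

theorem exists_perm_zero (i : Fin 4) : ∃ σ : Equiv.Perm (Fin 4), σ 0 = i :=
  ⟨Equiv.swap 0 i, Equiv.swap_apply_left 0 i⟩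

theorem exists_perm_zero_one {i j : Fin 4} (h : i < j) :
    ∃ σ : Equiv.Perm (Fin 4), σ 0 = i ∧ σ 1 = j := by
  revert i j
  decide +kernel

theorem exists_perm_two_three {i j : Fin 4} (h : i < j) :
    ∃ σ : Equiv.Perm (Fin 4), σ 2 = i ∧ σ 3 = j := by
  revert i j
  decide +kernel

theorem exists_fibre_eq_diagOrbit {φ : Finset (Fin 4) → ℕ} (hφ : φ ∈ phiList) (h6 : φ ≠ phi6) :
    ∃ w : MultiProj K 3 4, fibre K φ = diagOrbit w := by
  rcases hφ with rfl | ⟨i, rfl⟩ | ⟨i, j, hij, rfl⟩ | rfl | ⟨i, j, hij, rfl⟩ | ⟨i, j, hij, rfl⟩ |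
    ⟨i, rfl⟩ | rfl
  · exact ⟨_, fibre_phi8⟩
  · obtain ⟨σ, rfl⟩ := exists_perm_zero i
    exact ⟨_, fibre_phi7 σ⟩
  · obtain ⟨σ, rfl, rfl⟩ := exists_perm_two_three hij
    exact ⟨_, fibre_phi6p σ⟩
  · exact absurd rfl h6
  · obtain ⟨σ, rfl, rfl⟩ := exists_perm_zero_one hij
    exact ⟨_, fibre_phi5 σ⟩
  · obtain ⟨σ, rfl, rfl⟩ := exists_perm_zero_one hij
    exact ⟨_, fibre_phi4p σ⟩
  · obtain ⟨σ, rfl⟩ := exists_perm_zero i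
    exact ⟨_, fibre_phi4s σ⟩
  · exact ⟨_, fibre_phi2⟩

theorem fibre_eq_diagOrbit_of_mem {φ : Finset (Fin 4) → ℕ} (hφ : φ ∈ phiList) (h6 : φ ≠ phi6)
    {v : MultiProj K 3 4} (hv : v ∈ fibre K φ) : fibre K φ = diagOrbit v := by
  obtain ⟨w, hw⟩ := exists_fibre_eq_diagOrbit (K := K) hφ h6
  rw [hw] at hv ⊢
  exact (MulAction.orbit_eq_iff.mpr hv).symm

/-! ### The orbits `O(5;p)` -/

theorem represents_repLine (p : ℙ K (Fin 2 → K)) :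
    Represents ![![1, 0, 0], ![0, 1, 0], ![1, 1, 0], ![p.rep 0, p.rep 1, 0]] (repLine p) :=
  represents_tuple _ _

theorem mk_two_eq_iff {a b c d : K} (h : ![a, b] ≠ 0) (h' : ![c, d] ≠ 0) :
    Projectivization.mk K ![a, b] h = Projectivization.mk K ![c, d] h' ↔ a * d = b * c := by
  have hx : Represents (m := 2) ![![a, b], ![c, d]]
      ![Projectivization.mk K ![a, b] h, Projectivization.mk K ![c, d] h'] := fun i => by
    fin_cases i
    · exact ⟨h, rfl⟩
    · exact ⟨h', rfl⟩
  have := hx.eq_iff_minors 0 1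
  simp [Fin.forall_fin_two] at this
  rw [this]
  constructor
  · exact fun h => h.1
  · exact fun h => ⟨h, h.symm⟩

theorem rep_eq_vec (p : ℙ K (Fin 2 → K)) : p.rep = ![p.rep 0, p.rep 1] := by
  ext i; fin_cases i <;> rfl

theorem rep_vec_ne_zero (p : ℙ K (Fin 2 → K)) : ![p.rep 0, p.rep 1] ≠ 0 := by
  rw [← rep_eq_vec]
  exact p.rep_nonzero

theorem mk_rep_vec (p : ℙ K (Fin 2 → K)) :
    Projectivization.mk K ![p.rep 0, p.rep 1] (rep_vec_ne_zero p) = p := by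
  conv_rhs => rw [← p.mk_rep]
  congr 1
  exact (rep_eq_vec p).symm

theorem eq_mk_two_iff (p : ℙ K (Fin 2 → K)) {c d : K} (h : ![c, d] ≠ 0) :
    p = Projectivization.mk K ![c, d] h ↔ p.rep 0 * d = p.rep 1 * c := by
  rw [← mk_two_eq_iff (rep_vec_ne_zero p) h, mk_rep_vec]

theorem eq_iff_rep (p q : ℙ K (Fin 2 → K)) : p = q ↔ p.rep 0 * q.rep 1 = p.rep 1 * q.rep 0 := by
  rw [← eq_mk_two_iff p (rep_vec_ne_zero q), mk_rep_vec]

theorem mem_linePrime_iff (p : ℙ K (Fin 2 → K)) :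
    p ∈ linePrime K ↔ p.rep 0 ≠ 0 ∧ p.rep 1 ≠ 0 ∧ p.rep 0 ≠ p.rep 1 := by
  simp only [linePrime, Set.mem_ofPred_eq, ne_eq, eq_mk_two_iff, mul_zero, mul_one]
  rw [eq_comm (a := (0 : K))]
  tauto

theorem orbit5_eq_diagOrbit (p : ℙ K (Fin 2 → K)) : orbit5 p = diagOrbit (repLine p) := by
  have hy := represents_repLine p
  ext v
  constructor
  · rintro ⟨x, hx, h01, h2, h3⟩
    replace hx : Represents x v := hx
    obtain ⟨z, h⟩ := exists_det3_ne_zero (hx.not_minors h01)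
    exact hx.mem_diagOrbit hy (b := ![x 0, x 1, z]) h (fun _ => 1) (fun _ => one_ne_zero) id
      (fun _ => rfl) (fun i => by fin_cases i <;> simp [h2, h3])
  · rintro ⟨g, rfl⟩
    refine ⟨_, hy.smul g, ?_, ?_, ?_⟩
    · intro h
      have h : repLine p 0 = repLine p 1 :=
        MulAction.injective g (show g • repLine p 0 = g • repLine p 1 from h)
      rw [hy.eq_iff_minors] at h
      simpa using h 0 1
    · simp only [Matrix.cons_val, ← smul_add]
      congr 1
      ext k; fin_cases k <;> simp
    · change (g : Matrix (Fin 3) (Fin 3) K).mulVec _ =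
        p.rep 0 • (g : Matrix (Fin 3) (Fin 3) K).mulVec _ +
        p.rep 1 • (g : Matrix (Fin 3) (Fin 3) K).mulVec _
      rw [← Matrix.mulVec_smul, ← Matrix.mulVec_smul, ← Matrix.mulVec_add]
      congr 1
      ext k; fin_cases k <;> simp

theorem smul_mem_orbit5 {p : ℙ K (Fin 2 → K)} {v : MultiProj K 3 4} (hv : v ∈ orbit5 p)
    (g : GL (Fin 3) K) : g • v ∈ orbit5 p := by
  rw [orbit5_eq_diagOrbit] at hv ⊢
  exact MulAction.mem_orbit_of_mem_orbit g hv

theorem repLine_mem_orbit5 (p : ℙ K (Fin 2 → K)) : repLine p ∈ orbit5 p := by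
  rw [orbit5_eq_diagOrbit]
  exact MulAction.mem_orbit_self _

theorem orbit5_subset_fibre {p : ℙ K (Fin 2 → K)} (hp : p ∈ linePrime K) :
    orbit5 p ⊆ fibre K phi6 := by
  rw [orbit5_eq_diagOrbit]
  rintro _ ⟨g, rfl⟩
  refine smul_mem_fibre ?_ g
  have hy := represents_repLine p
  obtain ⟨h0, h1, h2⟩ := (mem_linePrime_iff p).mp hp
  rw [hy.mem_fibre_iff phi6_mem]
  simp only [hy.eq_iff_minors]
  simp +decide [Fin.forall_fin_succ, det3_eq, h0, h1, h2, h2.symm]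

theorem fibre_phi6_eq : fibre K phi6 = ⋃ p ∈ linePrime K, orbit5 p := by
  refine Set.Subset.antisymm (fun v hv => ?_) (Set.iUnion₂_subset fun p hp => orbit5_subset_fibre hp)
  obtain ⟨x, hx⟩ := exists_rep v
  replace hx : Represents x v := hx
  rw [hx.mem_fibre_iff phi6_mem] at hv
  simp +decide only [iff_true, iff_false] at hv
  obtain ⟨⟨h01, h02, h03, h12, h13, h23⟩, h012, h013, -⟩ := hv
  obtain ⟨α, β, e⟩ := exists_comb (hx.not_minors h01) h012
  obtain ⟨γ, δ, e'⟩ := exists_comb (hx.not_minors h01) h013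
  have hα : α ≠ 0 := by
    rintro rfl
    exact h12 (hx.eq_of_eq_smul (c := β) (by simpa using e)).symm
  have hβ : β ≠ 0 := by
    rintro rfl
    exact h02 (hx.eq_of_eq_smul (c := α) (by simpa using e)).symm
  have hγ : γ ≠ 0 := by
    rintro rfl
    exact h13 (hx.eq_of_eq_smul (c := δ) (by simpa using e')).symm
  have hδ : δ ≠ 0 := by
    rintro rfl
    exact h03 (hx.eq_of_eq_smul (c := γ) (by simpa using e')).symm
  -- in terms of `α x₀` and `β x₁`, the last point has the coordinates `γ / α` and `δ / β`
  have hne : ![γ / α, δ / β] ≠ 0 := fun h => div_ne_zero hγ hα (congrFun h 0)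
  let p := Projectivization.mk K ![γ / α, δ / β] hne
  obtain ⟨c, hc⟩ := Projectivization.exists_smul_eq_mk_rep K ![γ / α, δ / β] hne
  have p0 : p.rep 0 = c * (γ / α) := by
    change (Projectivization.mk K _ hne).rep 0 = _
    rw [← hc]; rfl
  have p1 : p.rep 1 = c * (δ / β) := by
    change (Projectivization.mk K _ hne).rep 1 = _
    rw [← hc]; rfl
  have hp : p ∈ linePrime K := by
    rw [mem_linePrime_iff, p0, p1]
    refine ⟨mul_ne_zero c.ne_zero (div_ne_zero hγ hα), mul_ne_zero c.ne_zero (div_ne_zero hδ hβ),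
      fun h => h23 ?_⟩
    have h := mul_left_cancel₀ c.ne_zero h
    symm
    refine hx.eq_of_eq_smul (c := γ / α) ?_
    rw [e', e, smul_add, smul_smul, smul_smul, div_mul_cancel₀ _ hα, h, div_mul_cancel₀ _ hβ]
  refine Set.mem_iUnion₂.mpr ⟨p, hp, ![α • x 0, β • x 1, x 2, (c : K) • x 3],
    hx.scale ![α, β, 1, c] ?_ ?_, h01, ?_, ?_⟩
  · intro i
    fin_cases i <;> simp [*]
  · intro i
    fin_cases i <;> simp
  · exact e
  · change (c : K) • x 3 = p.rep 0 • α • x 0 + p.rep 1 • β • x 1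
    rw [p0, p1, e', smul_smul, smul_smul, mul_assoc, mul_assoc, div_mul_cancel₀ _ hα,
      div_mul_cancel₀ _ hβ, smul_add, smul_smul, smul_smul]

/-- The equation saying that the cross-ratio of the four columns of `x` is `[p₁ : p₂]`, in terms of
minors. -/
def HasCrossRatio (p : ℙ K (Fin 2 → K)) (x : Fin 4 → Fin 3 → K) : Prop :=
  ∀ a b c d, p.rep 0 * ((x 0 a * x 3 b - x 0 b * x 3 a) * (x 1 c * x 2 d - x 1 d * x 2 c)) -
    p.rep 1 * ((x 0 a * x 2 b - x 0 b * x 2 a) * (x 1 c * x 3 d - x 1 d * x 3 c)) = 0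

theorem HasCrossRatio.of_orbit5 {p : ℙ K (Fin 2 → K)} {v : MultiProj K 3 4} (hv : v ∈ orbit5 p)
    {x : Fin 4 → Fin 3 → K} (hx : Represents x v) : HasCrossRatio p x := by
  obtain ⟨y, hy, -, h2, h3⟩ := hv
  have hc : ∀ i, ∃ c : K, x i = c • y i := by
    intro i
    obtain ⟨a, e⟩ := (Projectivization.mk_eq_mk_iff' K _ _ (hx i).1 (hy i).1).mp
      ((hx i).2.trans (hy i).2.symm)
    exact ⟨a, e.symm⟩
  choose c hc using hc
  intro i j k l
  simp only [hc, h2, h3, Pi.smul_apply, Pi.add_apply, smul_eq_mul]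
  ring

/-- The cross-ratio separates the orbits `O(5;p)`. -/
theorem eq_of_hasCrossRatio {p q : ℙ K (Fin 2 → K)} {v : MultiProj K 3 4} (hv : v ∈ orbit5 p)
    (hq : ∀ x, Represents x v → HasCrossRatio q x) : p = q := by
  obtain ⟨x, hx, h01, h2, h3⟩ := hv
  have h01' := Represents.not_minors hx h01
  push Not at h01'
  obtain ⟨a, b, hab⟩ := h01'
  have key := hq x hx a b a b
  rw [eq_iff_rep]
  have hne := sub_ne_zero.mpr hab
  simp only [h2, h3, Pi.smul_apply, Pi.add_apply, smul_eq_mul] at key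
  refine mul_right_cancel₀ (pow_ne_zero 2 hne) ?_
  linear_combination key

theorem pairwiseDisjoint_orbit5 : (linePrime K).PairwiseDisjoint orbit5 := by
  intro p _ q _ hpq
  refine Set.disjoint_left.mpr fun v hv hv' => hpq ?_
  exact eq_of_hasCrossRatio hv fun x hx => HasCrossRatio.of_orbit5 hv' hx

theorem infinite_linePrime [Infinite K] : (linePrime K).Infinite := by
  have hf : Function.Injective fun c : K =>
      Projectivization.mk K ![1, c] (fun h => one_ne_zero (congrFun h 0)) := by
    intro c d h
    rw [mk_two_eq_iff] at h
    simpa using h.symm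
  refine ((Set.toFinite {0, 1}).infinite_compl.image hf.injOn).mono ?_
  rintro _ ⟨c, hc, rfl⟩
  simp only [Set.mem_compl_iff, Set.mem_insert_iff, Set.mem_singleton_iff, not_or] at hc
  simp only [linePrime, Set.mem_ofPred_eq, ne_eq, mk_two_eq_iff]
  simpa [eq_comm] using hc

theorem infinite_orbit5 [Infinite K] : (orbit5 '' linePrime K).Infinite := by
  refine infinite_linePrime.image fun p hp q hq h => ?_
  by_contra hpq
  have := pairwiseDisjoint_orbit5 hp hq hpq
  exact Set.disjoint_left.mp this (repLine_mem_orbit5 p) (h ▸ repLine_mem_orbit5 p)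

/-! ### Zariski closures -/

theorem isClosed_zeroLocus {n m : ℕ} {S : Set (MvPolynomial (Fin m × Fin n) K)}
    (hS : ∀ f ∈ S, ∃ d, IsMultihomogeneous f d) : IsClosed (zeroLocus S) := by
  rw [← isOpen_compl_iff]
  exact ⟨S, hS, compl_compl _⟩

theorem exists_eq_zeroLocus {n m : ℕ} {Z : Set (MultiProj K n m)} (hZ : IsClosed Z) :
    ∃ S : Set (MvPolynomial (Fin m × Fin n) K),
      (∀ f ∈ S, ∃ d, IsMultihomogeneous f d) ∧ Z = zeroLocus S := by
  rw [← isOpen_compl_iff] at hZ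
  obtain ⟨S, hS, h⟩ := hZ
  exact ⟨S, hS, (compl_compl Z).symm.trans h⟩

theorem mem_closure_of_forall {n m : ℕ} {A : Set (MultiProj K n m)} {v : MultiProj K n m}
    (h : ∀ (f : MvPolynomial (Fin m × Fin n) K) (d : Fin m → ℕ), IsMultihomogeneous f d →
      (∀ w ∈ A, VanishesAt f w) → VanishesAt f v) : v ∈ closure A := by
  obtain ⟨S, hS, e⟩ := exists_eq_zeroLocus (isClosed_closure (s := A))
  rw [e]
  intro f hf
  obtain ⟨d, hd⟩ := hS f hf
  refine h f d hd fun w hw => ?_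
  have := subset_closure hw
  rw [e] at this
  exact this f hf

/-- If almost all points of an affine line of matrices represent points of `A`, then the remaining
ones represent points of the closure of `A`. -/
theorem mem_closure_of_line [Infinite K] {n m : ℕ} {A : Set (MultiProj K n m)}
    {v : MultiProj K n m} {a : Fin m → Fin n → K} (b : Fin m → Fin n → K) (F : Finset K)
    (h : ∀ t ∉ F, ∃ w ∈ A, Represents (fun i => a i + t • b i) w) (ha : Represents a v) :
    v ∈ closure A := by
  refine mem_closure_of_forall fun f d hd hf => ?_
  rw [vanishesAt_iff hd ha]
  set P : Polynomial K := MvPolynomial.aeval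
    (fun ik : Fin m × Fin n => Polynomial.C (a ik.1 ik.2) + Polynomial.X *
      Polynomial.C (b ik.1 ik.2)) f with hPdef
  have hP : ∀ t, P.eval t =
      MvPolynomial.eval (fun ik : Fin m × Fin n => (a ik.1 + t • b ik.1) ik.2) f := by
    intro t
    have : P.eval t = ((Polynomial.aeval t).comp (MvPolynomial.aeval
      (fun ik : Fin m × Fin n => Polynomial.C (a ik.1 ik.2) + Polynomial.X *
        Polynomial.C (b ik.1 ik.2)))) f := rfl
    clear_value P
    rw [this, MvPolynomial.comp_aeval]
    simp [MvPolynomial.aeval_eq_eval, mul_comm t]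
  have h0 : P = 0 := by
    refine Polynomial.eq_zero_of_infinite_isRoot P (F.finite_toSet.infinite_compl.mono ?_)
    intro t ht
    obtain ⟨w, hw, hr⟩ := h t ht
    have h1 := hf w hw (fun i => a i + t • b i) hr
    rw [Set.mem_ofPred_eq, Polynomial.IsRoot.def, hP]
    exact h1
  have := hP 0
  rw [h0] at this
  simpa using this.symm

/-- The invariant form of `mem_closure_of_line`: with one point, the closure of an invariant set
contains its orbit. -/
theorem diagOrbit_subset_closure [Infinite K] {A : Set (MultiProj K 3 4)}
    (hA : ∀ v ∈ A, ∀ g : GL (Fin 3) K, g • v ∈ A)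
    {v : MultiProj K 3 4} {a : Fin 4 → Fin 3 → K} (b : Fin 4 → Fin 3 → K) (F : Finset K)
    (h : ∀ t ∉ F, ∃ w ∈ A, Represents (fun i => a i + t • b i) w) (ha : Represents a v) :
    diagOrbit v ⊆ closure A := by
  rintro _ ⟨g, rfl⟩
  refine mem_closure_of_line (fun i => g • b i) F (fun t ht => ?_) (ha.smul g)
  obtain ⟨w, hw, hr⟩ := h t ht
  refine ⟨g • w, hA w hw g, ?_⟩
  convert hr.smul g using 2 with i
  rw [smul_add, smul_comm t g]

/-- A degeneration of one point of a fibre, transported by a permutation of the positions. -/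
theorem fibre_subset_closure [Infinite K] {φ φ' ψ' : Finset (Fin 4) → ℕ} {w : MultiProj K 3 4}
    {σ : Equiv.Perm (Fin 4)} (h : ∀ I, φ' (I.image σ) = φ I)
    (hw : fibre K ψ' = diagOrbit (permTuple σ w)) {a : Fin 4 → Fin 3 → K}
    (ha : Represents a w) (b : Fin 4 → Fin 3 → K) (F : Finset K)
    (hne : ∀ t ∉ F, ∀ i, a i + t • b i ≠ 0)
    (hmem : ∀ t ∉ F, ∀ u, Represents (fun i => a i + t • b i) u → u ∈ fibre K φ) :
    fibre K ψ' ⊆ closure (fibre K φ') := by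
  rw [hw]
  refine diagOrbit_subset_closure (fun v hv g => smul_mem_fibre hv g) (fun i => b (σ.symm i)) F
    (fun t ht => ?_) (ha.permTuple σ)
  have hr := represents_tuple _ (hne t ht)
  refine ⟨permTuple σ (tuple _ (hne t ht)), ?_, hr.permTuple σ⟩
  rw [permTuple_mem_fibre h]
  exact hmem t ht _ hr

/-! ### The degenerations along the edges of the diagram -/

section Degenerations

variable [Infinite K]

theorem fibre_phi7_subset (i : Fin 4) : fibre K (phi7 i) ⊆ closure (fibre K phi8) := by
  obtain ⟨σ, rfl⟩ := exists_perm_zero i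
  refine fibre_subset_closure (σ := σ) (φ := phi8) (by revert σ; decide +kernel) (fibre_phi7 σ)
    (represents_tuple _ _) ![0, 0, 0, ![1, 0, 0]] {0} ?_ ?_
  · intro t ht i
    fin_cases i <;> simp
  · intro t ht u hu
    rw [hu.mem_fibre_iff phi8_mem]
    simp only [hu.eq_iff_minors]
    simp only [Finset.mem_singleton] at ht
    simp +decide [Fin.forall_fin_succ, det3_eq, ht]

theorem fibre_phi6p_subset {i j k : Fin 4} (hij : i ≠ j) (hik : i ≠ k) (hjk : j < k) :
    fibre K (phi6p j k) ⊆ closure (fibre K (phi7 i)) := by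
  have hσ : ∀ i j k : Fin 4, i ≠ j → i ≠ k → j < k →
      ∃ σ : Equiv.Perm (Fin 4), σ 0 = i ∧ σ 2 = j ∧ σ 3 = k := by decide +kernel
  obtain ⟨σ, rfl, rfl, rfl⟩ := hσ i j k hij hik hjk
  refine fibre_subset_closure (σ := σ) (φ := phi7 0) (by clear hij hik hjk; revert σ; decide +kernel)
    (fibre_phi6p σ)
    (represents_tuple _ _) ![0, 0, 0, ![0, 1, 0]] {0} ?_ ?_
  · intro t ht i
    fin_cases i <;> simp
  · intro t ht u hu
    rw [hu.mem_fibre_iff (phi7_mem 0)]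
    simp only [hu.eq_iff_minors]
    simp only [Finset.mem_singleton] at ht
    simp +decide [Fin.forall_fin_succ, det3_eq, ht]

theorem fibre_phi6_subset (i : Fin 4) : fibre K phi6 ⊆ closure (fibre K (phi7 i)) := by
  rw [fibre_phi6_eq]
  refine Set.iUnion₂_subset fun p hp => ?_
  obtain ⟨h0, h1, h2⟩ := (mem_linePrime_iff p).mp hp
  rw [orbit5_eq_diagOrbit]
  refine diagOrbit_subset_closure (fun v hv g => smul_mem_fibre hv g) (Pi.single i ![0, 0, 1]) {0}
    (fun t ht => ?_) (represents_repLine p)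
  simp only [Finset.mem_singleton] at ht
  have hne : ∀ j, (![![1, 0, 0], ![0, 1, 0], ![1, 1, 0], ![p.rep 0, p.rep 1, 0]] :
      Fin 4 → Fin 3 → K) j + t • (Pi.single i ![0, 0, 1] : Fin 4 → Fin 3 → K) j ≠ 0 := by
    intro j
    fin_cases i <;> fin_cases j <;> simp [h0]
  have hu := represents_tuple _ hne
  refine ⟨_, ?_, hu⟩
  rw [hu.mem_fibre_iff (phi7_mem i)]
  simp only [hu.eq_iff_minors]
  have e : ¬ t * p.rep 1 - t * p.rep 0 = 0 := by
    rw [← mul_sub]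
    exact mul_ne_zero ht (sub_ne_zero.mpr h2.symm)
  fin_cases i <;> simp +decide [Fin.forall_fin_succ, det3_eq, ht, h0, h1, h2, h2.symm, e]

theorem fibre_phi5_subset_phi6p {i j : Fin 4} (hij : i < j) :
    fibre K (phi5 i j) ⊆ closure (fibre K (phi6p i j)) := by
  obtain ⟨σ, rfl, rfl⟩ := exists_perm_zero_one hij
  refine fibre_subset_closure (σ := σ) (φ := phi6p 0 1) (by clear hij; revert σ; decide +kernel)
    (fibre_phi5 σ) (represents_tuple _ _) ![0, 0, 0, ![0, 0, 1]] {0} ?_ ?_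
  · intro t ht i
    fin_cases i <;> simp
  · intro t ht u hu
    rw [hu.mem_fibre_iff (phi6p_mem zero_ne_one)]
    simp only [hu.eq_iff_minors]
    simp only [Finset.mem_singleton] at ht
    simp +decide [Fin.forall_fin_succ, det3_eq, ht]

theorem fibre_phi5_subset_phi6 {i j : Fin 4} (hij : i < j) :
    fibre K (phi5 i j) ⊆ closure (fibre K phi6) := by
  classical
  obtain ⟨σ, rfl, rfl⟩ := exists_perm_zero_one hij
  refine fibre_subset_closure (σ := σ) (φ := phi6) (by clear hij; revert σ; decide +kernel)
    (fibre_phi5 σ) (represents_tuple _ _) ![0, ![0, 1, 0], 0, 0] {0, 1} ?_ ?_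
  · intro t ht i
    fin_cases i <;> simp
  · intro t ht u hu
    rw [hu.mem_fibre_iff phi6_mem]
    simp only [hu.eq_iff_minors]
    simp only [Finset.mem_insert, Finset.mem_singleton, not_or] at ht
    simp +decide [Fin.forall_fin_succ, det3_eq, ht, Ne.symm ht.2]

theorem fibre_phi4p_subset {i j : Fin 4} (hij : i < j) :
    fibre K (phi4p i j) ⊆ closure (fibre K (phi5 i j)) := by
  obtain ⟨σ, rfl, rfl⟩ := exists_perm_zero_one hij
  refine fibre_subset_closure (σ := σ) (φ := phi5 0 1) (by clear hij; revert σ; decide +kernel)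
    (fibre_phi4p σ) (represents_tuple _ _) ![0, 0, 0, ![1, 0, 0]] {0} ?_ ?_
  · intro t ht i
    fin_cases i <;> simp
  · intro t ht u hu
    rw [hu.mem_fibre_iff (phi5_mem zero_ne_one)]
    simp only [hu.eq_iff_minors]
    simp only [Finset.mem_singleton] at ht
    simp +decide [Fin.forall_fin_succ, det3_eq, ht]

theorem fibre_phi4s_subset {i j k : Fin 4} (hij : i < j) (hki : k ≠ i) (hkj : k ≠ j) :
    fibre K (phi4s k) ⊆ closure (fibre K (phi5 i j)) := by
  have hσ : ∀ i j k : Fin 4, i < j → k ≠ i → k ≠ j →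
      ∃ σ : Equiv.Perm (Fin 4), σ 0 = k ∧ σ 1 = i ∧ σ 2 = j := by decide +kernel
  obtain ⟨σ, rfl, rfl, rfl⟩ := hσ i j k hij hki hkj
  refine fibre_subset_closure (σ := σ) (φ := phi5 1 2) (by clear hij hki hkj; revert σ; decide +kernel)
    (fibre_phi4s σ) (represents_tuple _ _) ![0, 0, 0, ![1, 0, 0]] {0} ?_ ?_
  · intro t ht i
    fin_cases i <;> simp
  · intro t ht u hu
    rw [hu.mem_fibre_iff (phi5_mem (by decide))]
    simp only [hu.eq_iff_minors]
    simp only [Finset.mem_singleton] at ht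
    simp +decide [Fin.forall_fin_succ, det3_eq, ht]

theorem fibre_phi2_subset_phi4p {i j : Fin 4} (hij : i < j) :
    fibre K phi2 ⊆ closure (fibre K (phi4p i j)) := by
  obtain ⟨σ, rfl, rfl⟩ := exists_perm_zero_one hij
  refine fibre_subset_closure (σ := σ) (φ := phi4p 0 1) (by clear hij; revert σ; decide +kernel)
    (fibre_eq_diagOrbit_permTuple fibre_phi2 (by clear hij; revert σ; decide +kernel))
    (represents_tuple _ _) ![0, 0, ![0, 1, 0], ![0, 1, 0]] {0} ?_ ?_
  · intro t ht i
    fin_cases i <;> simp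
  · intro t ht u hu
    rw [hu.mem_fibre_iff (phi4p_mem zero_ne_one)]
    simp only [hu.eq_iff_minors]
    simp only [Finset.mem_singleton] at ht
    simp +decide [Fin.forall_fin_succ, det3_eq, ht]

theorem fibre_phi2_subset_phi4s (i : Fin 4) :
    fibre K phi2 ⊆ closure (fibre K (phi4s i)) := by
  obtain ⟨σ, rfl⟩ := exists_perm_zero i
  refine fibre_subset_closure (σ := σ) (φ := phi4s 0) (by revert σ; decide +kernel)
    (fibre_eq_diagOrbit_permTuple fibre_phi2 (by revert σ; decide +kernel))
    (represents_tuple _ _) ![![0, 1, 0], 0, 0, 0] {0} ?_ ?_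
  · intro t ht i
    fin_cases i <;> simp
  · intro t ht u hu
    rw [hu.mem_fibre_iff (phi4s_mem 0)]
    simp only [hu.eq_iff_minors]
    simp only [Finset.mem_singleton] at ht
    simp +decide [Fin.forall_fin_succ, det3_eq, ht]

/-- The one-parameter group `diag (1, t)` fixes the `i`-th point `[e₂]` and contracts the other
points to `[e₁]`. -/
theorem fibre_phi4s_subset_closure_of_curve {p : ℙ K (Fin 2 → K)} (i : Fin 4)
    {a b : Fin 4 → Fin 3 → K} {c : K → Fin 4 → K} (hc : ∀ t : K, t ≠ 0 → ∀ j, c t j ≠ 0)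
    (ha : ∀ u, Represents a u → u ∈ fibre K (phi4s i))
    (ha0 : ∀ j, a j ≠ 0) (hab : ∀ t : K, t ≠ 0 → ∀ j, a j + t • b j ≠ 0)
    (h01 : ∀ t : K, t ≠ 0 → ∃ k l, (a 0 + t • b 0) k * (a 1 + t • b 1) l ≠
      (a 0 + t • b 0) l * (a 1 + t • b 1) k)
    (h2 : ∀ t : K, t ≠ 0 → c t 2 • (a 2 + t • b 2) = c t 0 • (a 0 + t • b 0) + c t 1 • (a 1 + t • b 1))
    (h3 : ∀ t : K, t ≠ 0 → c t 3 • (a 3 + t • b 3) =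
      p.rep 0 • c t 0 • (a 0 + t • b 0) + p.rep 1 • c t 1 • (a 1 + t • b 1)) :
    fibre K (phi4s i) ⊆ closure (orbit5 p) := by
  have hr := represents_tuple a ha0
  rw [fibre_eq_diagOrbit_of_mem (phi4s_mem i) (by clear ha; revert i; decide +kernel) (ha _ hr)]
  refine diagOrbit_subset_closure (fun v hv g => smul_mem_orbit5 hv g) b {0} (fun t ht => ?_) hr
  simp only [Finset.mem_singleton] at ht
  have hu := represents_tuple _ (hab t ht)
  refine ⟨_, ⟨_, hu.scale (c t) (hc t ht) (fun j => rfl), fun h => ?_, h2 t ht, h3 t ht⟩, hu⟩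
  rw [hu.eq_iff_minors] at h
  obtain ⟨k, l, hkl⟩ := h01 t ht
  exact hkl (h k l)

theorem fibre_phi4s_subset_orbit5 {p : ℙ K (Fin 2 → K)} (hp : p ∈ linePrime K) (i : Fin 4) :
    fibre K (phi4s i) ⊆ closure (orbit5 p) := by
  obtain ⟨h0, h1, h2⟩ := (mem_linePrime_iff p).mp hp
  have h2' := sub_ne_zero.mpr h2
  fin_cases i
  · refine fibre_phi4s_subset_closure_of_curve 0
      (a := ![![0, 1, 0], ![1, 0, 0], ![1, 0, 0], ![p.rep 1, 0, 0]])
      (b := ![0, 0, ![0, 1, 0], ![0, p.rep 0, 0]]) (c := fun t => ![t, 1, 1, 1]) ?_ ?_ ?_ ?_ ?_ ?_ ?_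
    · intro t ht j
      fin_cases j <;> simp [ht]
    · intro u hu
      rw [hu.mem_fibre_iff (phi4s_mem _)]
      simp only [hu.eq_iff_minors]
      simp +decide [Fin.forall_fin_succ, det3_eq, h1]
    · intro j
      fin_cases j <;> simp [h1]
    · intro t ht j
      fin_cases j <;> simp [h0, h1]
    · intro t ht
      exact ⟨0, 1, by simp⟩
    · intro t ht
      ext k; fin_cases k <;> simp
    · intro t ht
      ext k; fin_cases k <;> simp; ring
  · refine fibre_phi4s_subset_closure_of_curve 1
      (a := ![![1, 0, 0], ![0, 1, 0], ![1, 0, 0], ![p.rep 0, 0, 0]])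
      (b := ![0, 0, ![0, 1, 0], ![0, p.rep 1, 0]]) (c := fun t => ![1, t, 1, 1]) ?_ ?_ ?_ ?_ ?_ ?_ ?_
    · intro t ht j
      fin_cases j <;> simp [ht]
    · intro u hu
      rw [hu.mem_fibre_iff (phi4s_mem _)]
      simp only [hu.eq_iff_minors]
      simp +decide [Fin.forall_fin_succ, det3_eq, h0]
    · intro j
      fin_cases j <;> simp [h0]
    · intro t ht j
      fin_cases j <;> simp [h0, h1]
    · intro t ht
      exact ⟨0, 1, by simp⟩
    · intro t ht
      ext k; fin_cases k <;> simp
    · intro t ht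
      ext k; fin_cases k <;> simp; ring
  · refine fibre_phi4s_subset_closure_of_curve 2
      (a := ![![1, 0, 0], ![-1, 0, 0], ![0, 1, 0], ![p.rep 0 - p.rep 1, 0, 0]])
      (b := ![0, ![0, 1, 0], 0, ![0, p.rep 1, 0]]) (c := fun t => ![1, 1, t, 1]) ?_ ?_ ?_ ?_ ?_ ?_ ?_
    · intro t ht j
      fin_cases j <;> simp [ht]
    · intro u hu
      rw [hu.mem_fibre_iff (phi4s_mem _)]
      simp only [hu.eq_iff_minors]
      simp +decide [Fin.forall_fin_succ, det3_eq, h2']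
    · intro j
      fin_cases j <;> simp [h2']
    · intro t ht j
      fin_cases j <;> simp [h2']
    · intro t ht
      exact ⟨0, 1, by simp [ht]⟩
    · intro t ht
      ext k; fin_cases k <;> simp
    · intro t ht
      ext k; fin_cases k <;> simp <;> ring
  · have h2'' := sub_ne_zero.mpr h2.symm
    refine fibre_phi4s_subset_closure_of_curve 3
      (a := ![![p.rep 1, 0, 0], ![-p.rep 0, 0, 0], ![p.rep 1 - p.rep 0, 0, 0], ![0, 1, 0]])
      (b := ![0, ![0, 1, 0], ![0, 1, 0], 0]) (c := fun t => ![1, 1, 1, p.rep 1 * t]) ?_ ?_ ?_ ?_ ?_ ?_ ?_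
    · intro t ht j
      fin_cases j <;> simp [ht, h1]
    · intro u hu
      rw [hu.mem_fibre_iff (phi4s_mem _)]
      simp only [hu.eq_iff_minors]
      simp +decide [Fin.forall_fin_succ, det3_eq, h0, h1, h2'']
    · intro j
      fin_cases j <;> simp [h0, h1, h2'']
    · intro t ht j
      fin_cases j <;> simp [h0, h1, h2'']
    · intro t ht
      exact ⟨0, 1, by simp [ht, h1]⟩
    · intro t ht
      ext k; fin_cases k <;> simp; ring
    · intro t ht
      ext k; fin_cases k <;> simp ; ring

/-- Every edge of the diagram is a closure relation. -/
theorem stratum_subset_of_edge {p : ℙ K (Fin 2 → K)} (hp : p ∈ linePrime K) {a b : Node}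
    (h : Edge a b) : stratum p b ⊆ closure (stratum p a) := by
  cases h with
  | e8_7 i => exact fibre_phi7_subset i
  | e7_6p i j k hij hik hjk => exact fibre_phi6p_subset hij hik hjk
  | e7_6 i => exact fibre_phi6_subset i
  | e6p_5 i j hij => exact fibre_phi5_subset_phi6p hij
  | e6_5 i j hij => exact fibre_phi5_subset_phi6 hij
  | e6_orb => exact (orbit5_subset_fibre hp).trans subset_closure
  | e5_4p i j hij => exact fibre_phi4p_subset hij
  | e5_4s i j k hij hki hkj => exact fibre_phi4s_subset hij hki hkj
  | orb_4s i => exact fibre_phi4s_subset_orbit5 hp i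
  | e4p_2 i j hij => exact fibre_phi2_subset_phi4p hij
  | e4s_2 i => exact fibre_phi2_subset_phi4s i

theorem stratum_subset_of_reachable {p : ℙ K (Fin 2 → K)} (hp : p ∈ linePrime K) {a b : Node}
    (h : Relation.ReflTransGen Edge a b) : stratum p b ⊆ closure (stratum p a) := by
  induction h with
  | refl => exact subset_closure
  | tail _ hbc ih =>
    exact (stratum_subset_of_edge hp hbc).trans (closure_minimal ih isClosed_closure)

end Degenerations

/-! ### Closed conditions and the closures of the strata -/

section Polynomials

open MvPolynomial

/-- The `2 × 2`-minor of the rows `a`, `b` in the columns `i`, `j`. -/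
noncomputable def minorPoly (K : Type*) [Field K] {n m : ℕ} (i j : Fin m) (a b : Fin n) :
    MvPolynomial (Fin m × Fin n) K :=
  X (i, a) * X (j, b) - X (i, b) * X (j, a)

theorem isMultihomogeneous_X {n m : ℕ} (i : Fin m) (a : Fin n) :
    IsMultihomogeneous (X (i, a) : MvPolynomial (Fin m × Fin n) K) (Pi.single i 1) :=
  isWeightedHomogeneous_X K _ (i, a)

theorem isMultihomogeneous_minorPoly {n m : ℕ} (i j : Fin m) (a b : Fin n) :
    IsMultihomogeneous (minorPoly K i j a b) (Pi.single i 1 + Pi.single j 1) :=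
  ((isMultihomogeneous_X i a).mul (isMultihomogeneous_X j b)).sub
    ((isMultihomogeneous_X i b).mul (isMultihomogeneous_X j a))

theorem eval_minorPoly {n m : ℕ} (i j : Fin m) (a b : Fin n) (x : Fin m → Fin n → K) :
    eval (fun ik : Fin m × Fin n => x ik.1 ik.2) (minorPoly K i j a b) =
      x i a * x j b - x i b * x j a := by
  simp [minorPoly]

/-- The determinant of the columns `i`, `j`, `k`. -/
noncomputable def detPoly (K : Type*) [Field K] {m : ℕ} (i j k : Fin m) : MvPolynomial (Fin m × Fin 3) K :=
  X (i, 0) * minorPoly K j k 1 2 - X (i, 1) * minorPoly K j k 0 2 + X (i, 2) * minorPoly K j k 0 1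

theorem isMultihomogeneous_detPoly {m : ℕ} (i j k : Fin m) :
    IsMultihomogeneous (detPoly K i j k) (Pi.single i 1 + (Pi.single j 1 + Pi.single k 1)) :=
  (((isMultihomogeneous_X i 0).mul (isMultihomogeneous_minorPoly j k 1 2)).sub
    ((isMultihomogeneous_X i 1).mul (isMultihomogeneous_minorPoly j k 0 2))).add
    ((isMultihomogeneous_X i 2).mul (isMultihomogeneous_minorPoly j k 0 1))

theorem eval_detPoly {m : ℕ} (i j k : Fin m) (x : Fin m → Fin 3 → K) :
    eval (fun ik : Fin m × Fin 3 => x ik.1 ik.2) (detPoly K i j k) = det3 (x i) (x j) (x k) := by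
  simp only [detPoly, map_add, map_sub, map_mul, eval_X, eval_minorPoly, det3_eq]
  ring

/-- The equations of `HasCrossRatio`. -/
noncomputable def crossRatioPoly (p : ℙ K (Fin 2 → K)) (a b c d : Fin 3) : MvPolynomial (Fin 4 × Fin 3) K :=
  C (p.rep 0) * (minorPoly K 0 3 a b * minorPoly K 1 2 c d) -
    C (p.rep 1) * (minorPoly K 0 2 a b * minorPoly K 1 3 c d)

theorem isMultihomogeneous_crossRatioPoly (p : ℙ K (Fin 2 → K)) (a b c d : Fin 3) :
    IsMultihomogeneous (crossRatioPoly p a b c d)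
      (Pi.single 0 1 + Pi.single 3 1 + (Pi.single 1 1 + Pi.single 2 1)) := by
  refine (((isMultihomogeneous_minorPoly 0 3 a b).mul
    (isMultihomogeneous_minorPoly 1 2 c d)).C_mul _).sub ?_
  have := ((isMultihomogeneous_minorPoly (K := K) (m := 4) 0 2 a b).mul
    (isMultihomogeneous_minorPoly 1 3 c d)).C_mul (p.rep 1)
  have e : (Pi.single 0 1 + Pi.single 3 1 + (Pi.single 1 1 + Pi.single 2 1) : Fin 4 → ℕ) =
      Pi.single 0 1 + Pi.single 2 1 + (Pi.single 1 1 + Pi.single 3 1) := by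
    funext i
    simp only [Pi.add_apply]
    omega
  rw [e]
  exact this

theorem eval_crossRatioPoly (p : ℙ K (Fin 2 → K)) (a b c d : Fin 3) (x : Fin 4 → Fin 3 → K) :
    eval (fun ik : Fin 4 × Fin 3 => x ik.1 ik.2) (crossRatioPoly p a b c d) =
      p.rep 0 * ((x 0 a * x 3 b - x 0 b * x 3 a) * (x 1 c * x 2 d - x 1 d * x 2 c)) -
        p.rep 1 * ((x 0 a * x 2 b - x 0 b * x 2 a) * (x 1 c * x 3 d - x 1 d * x 3 c)) := by
  simp only [crossRatioPoly, map_sub, map_mul, eval_C, eval_minorPoly]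

end Polynomials

theorem isClosed_setOf_vanishesAt {n m : ℕ} {f : MvPolynomial (Fin m × Fin n) K} {d : Fin m → ℕ}
    (hf : IsMultihomogeneous f d) : IsClosed {v : MultiProj K n m | VanishesAt f v} := by
  have : {v : MultiProj K n m | VanishesAt f v} = zeroLocus {f} := by
    ext v
    simp [zeroLocus]
  rw [this]
  exact isClosed_zeroLocus fun g hg => ⟨d, by rw [Set.mem_singleton_iff.mp hg]; exact hf⟩

theorem isClosed_rankMap_le {φ : Finset (Fin 4) → ℕ} (hφ : φ ∈ phiList) :
    IsClosed {v : MultiProj K 3 4 | rankMap v ≤ φ} := by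
  have : {v : MultiProj K 3 4 | rankMap v ≤ φ} =
      (⋂ (i) (j) (_ : φ {i, j} ≤ 1) (a) (b), {v | VanishesAt (minorPoly K i j a b) v}) ∩
        ⋂ (i) (j) (k) (_ : φ {i, j, k} ≤ 2), {v | VanishesAt (detPoly K i j k) v} := by
    ext v
    obtain ⟨x, hx⟩ := exists_rep v
    replace hx : Represents x v := hx
    simp only [Set.mem_ofPred_eq, hx.rankMap_le_iff hφ, Set.mem_inter_iff, Set.mem_iInter,
      vanishesAt_iff (isMultihomogeneous_minorPoly _ _ _ _) hx,
      vanishesAt_iff (isMultihomogeneous_detPoly _ _ _) hx, eval_minorPoly, eval_detPoly]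
  rw [this]
  refine IsClosed.inter ?_ ?_
  · exact isClosed_iInter fun i => isClosed_iInter fun j => isClosed_iInter fun _ =>
      isClosed_iInter fun a => isClosed_iInter fun b =>
        isClosed_setOf_vanishesAt (isMultihomogeneous_minorPoly i j a b)
  · exact isClosed_iInter fun i => isClosed_iInter fun j => isClosed_iInter fun k =>
      isClosed_iInter fun _ => isClosed_setOf_vanishesAt (isMultihomogeneous_detPoly i j k)

theorem isClosed_hasCrossRatio (p : ℙ K (Fin 2 → K)) :
    IsClosed {v : MultiProj K 3 4 | ∀ x, Represents x v → HasCrossRatio p x} := by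
  have : {v : MultiProj K 3 4 | ∀ x, Represents x v → HasCrossRatio p x} =
      ⋂ (a) (b) (c) (d), {v | VanishesAt (crossRatioPoly p a b c d) v} := by
    ext v
    simp only [Set.mem_ofPred_eq, Set.mem_iInter, VanishesAt, eval_crossRatioPoly]
    exact ⟨fun h a b c d x hx => h x hx a b c d, fun h x hx a b c d => h a b c d x hx⟩
  rw [this]
  exact isClosed_iInter fun a => isClosed_iInter fun b => isClosed_iInter fun c =>
    isClosed_iInter fun d => isClosed_setOf_vanishesAt (isMultihomogeneous_crossRatioPoly p a b c d)

theorem closure_fibre_subset {φ : Finset (Fin 4) → ℕ} (hφ : φ ∈ phiList) :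
    closure (fibre K φ) ⊆ ⋃ ψ ≤ φ, fibre K ψ := by
  intro v hv
  have h : v ∈ {v : MultiProj K 3 4 | rankMap v ≤ φ} :=
    closure_minimal (fun w hw => (show rankMap w = φ from hw).le) (isClosed_rankMap_le hφ) hv
  exact Set.mem_iUnion₂.mpr ⟨rankMap v, h, rfl⟩

theorem linePrime_nonempty [Infinite K] : (linePrime K).Nonempty :=
  infinite_linePrime.nonempty

theorem closure_fibre [Infinite K] {φ : Finset (Fin 4) → ℕ} (hφ : φ ∈ phiList) :
    closure (fibre K φ) = ⋃ ψ ≤ φ, fibre K ψ := by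
  refine Set.Subset.antisymm (closure_fibre_subset hφ) (Set.iUnion₂_subset fun ψ hψ v hv => ?_)
  obtain ⟨p, hp⟩ := linePrime_nonempty (K := K)
  exact stratum_subset_of_reachable hp
    (reachable_of_le hφ (mem_phiList_of_mem_fibre hv) hψ) hv

/-- Coordinates for four collinear points, two of which, `i` and `j`, coincide. -/
theorem Represents.exists_coords_of_eq {x : Fin 4 → Fin 3 → K} {v : MultiProj K 3 4}
    (hx : Represents x v) {i j k l : Fin 4} (hij : v i = v j) (hik : v i ≠ v k) (hil : v i ≠ v l)
    (h : det3 (x i) (x k) (x l) = 0) :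
    ∃ (c α β : K) (a b : Fin 3), x j = c • x i ∧ x l = α • x i + β • x k ∧
      c * β * (x i a * x k b - x i b * x k a) ^ 2 ≠ 0 := by
  obtain ⟨c, hc⟩ := (Projectivization.mk_eq_mk_iff' K _ _ (hx j).1 (hx i).1).mp
    ((hx j).2.trans (hij.symm.trans (hx i).2.symm))
  obtain ⟨α, β, e⟩ := exists_comb (hx.not_minors hik) h
  have hab := hx.not_minors hik
  push Not at hab
  obtain ⟨a, b, hab⟩ := hab
  refine ⟨c, α, β, a, b, hc.symm, e, mul_ne_zero (mul_ne_zero ?_ ?_)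
    (pow_ne_zero 2 (sub_ne_zero.mpr hab))⟩
  · rintro rfl
    exact hx.ne_zero j (by rw [← hc, zero_smul])
  · rintro rfl
    exact hil (hx.eq_of_eq_smul (c := α) (by simpa using e)).symm

/-- Among four collinear points with cross-ratio different from `0`, `1`, `∞`, it does not happen
that exactly two coincide, nor that they coincide in two pairs. -/
theorem Represents.not_hasCrossRatio {x : Fin 4 → Fin 3 → K} {v : MultiProj K 3 4}
    (hx : Represents x v) {p : ℙ K (Fin 2 → K)} (hp : p ∈ linePrime K)
    (h6 : ∀ i j k, det3 (x i) (x j) (x k) = 0) {i j : Fin 4} (hij : i < j) (h : v i = v j)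
    (hk : ∀ k, k ≠ i → k ≠ j → v i ≠ v k) : ¬ HasCrossRatio p x := by
  intro hc
  obtain ⟨h0, h1, h2⟩ := (mem_linePrime_iff p).mp hp
  have h2 := sub_ne_zero.mpr h2
  have key : ∀ k l, k ≠ i → k ≠ j → l ≠ i → l ≠ j → ∃ (c α β : K) (a b : Fin 3), x j = c • x i ∧
      x l = α • x i + β • x k ∧ c * β * (x i a * x k b - x i b * x k a) ^ 2 ≠ 0 :=
    fun k l hki hkj hli hlj => hx.exists_coords_of_eq h (hk k hki hkj) (hk l hli hlj) (h6 i k l)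
  have pairs : ∀ i j : Fin 4, i < j → (i = 0 ∧ j = 1) ∨ (i = 0 ∧ j = 2) ∨ (i = 0 ∧ j = 3) ∨
      (i = 1 ∧ j = 2) ∨ (i = 1 ∧ j = 3) ∨ (i = 2 ∧ j = 3) := by decide +kernel
  rcases pairs i j hij with ⟨rfl, rfl⟩ | ⟨rfl, rfl⟩ | ⟨rfl, rfl⟩ | ⟨rfl, rfl⟩ | ⟨rfl, rfl⟩ |
    ⟨rfl, rfl⟩
  · obtain ⟨c, α, β, a, b, ej, el, hne⟩ := key 2 3 (by decide) (by decide) (by decide) (by decide)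
    have e := hc a b a b
    simp only [ej, el, Pi.smul_apply, Pi.add_apply, smul_eq_mul] at e
    refine mul_ne_zero h2 hne ?_
    linear_combination e
  · obtain ⟨c, α, β, a, b, ej, el, hne⟩ := key 1 3 (by decide) (by decide) (by decide) (by decide)
    have e := hc a b a b
    simp only [ej, el, Pi.smul_apply, Pi.add_apply, smul_eq_mul] at e
    refine mul_ne_zero h0 hne ?_
    linear_combination -e
  · obtain ⟨c, α, β, a, b, ej, el, hne⟩ := key 1 2 (by decide) (by decide) (by decide) (by decide)
    have e := hc a b a b
    simp only [ej, el, Pi.smul_apply, Pi.add_apply, smul_eq_mul] at e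
    refine mul_ne_zero h1 hne ?_
    linear_combination e
  · obtain ⟨c, α, β, a, b, ej, el, hne⟩ := key 0 3 (by decide) (by decide) (by decide) (by decide)
    have e := hc a b a b
    simp only [ej, el, Pi.smul_apply, Pi.add_apply, smul_eq_mul] at e
    refine mul_ne_zero h1 hne ?_
    linear_combination e
  · obtain ⟨c, α, β, a, b, ej, el, hne⟩ := key 0 2 (by decide) (by decide) (by decide) (by decide)
    have e := hc a b a b
    simp only [ej, el, Pi.smul_apply, Pi.add_apply, smul_eq_mul] at e
    refine mul_ne_zero h0 hne ?_
    linear_combination -e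
  · obtain ⟨c, α, β, a, b, ej, el, hne⟩ := key 0 1 (by decide) (by decide) (by decide) (by decide)
    have e := hc a b a b
    simp only [ej, el, Pi.smul_apply, Pi.add_apply, smul_eq_mul] at e
    refine mul_ne_zero h2 hne ?_
    linear_combination e

/-- A point of rank at most `2` with the cross-ratio `p` lies in `O(5;p)`, or at least three of its
entries coincide. -/
theorem mem_orbit5_or_of_hasCrossRatio {p : ℙ K (Fin 2 → K)} (hp : p ∈ linePrime K)
    {v : MultiProj K 3 4} (h6 : rankMap v ≤ phi6)
    (hv : ∀ x, Represents x v → HasCrossRatio p x) :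
    v ∈ orbit5 p ∨ (∃ i, v ∈ fibre K (phi4s i)) ∨ v ∈ fibre K phi2 := by
  obtain ⟨x, hx⟩ := exists_rep v
  replace hx : Represents x v := hx
  have hdet : ∀ i j k, det3 (x i) (x j) (x k) = 0 := fun i j k =>
    ((hx.rankMap_le_iff phi6_mem).mp h6).2 i j k (by revert i j k; decide +kernel)
  have hφ := rankMap_mem_phiList v
  generalize hr : rankMap v = φ at h6 hφ
  have hpair : ∀ i j, v i = v j ↔ φ {i, j} ≤ 1 := fun i j => by
    rw [← hr, rankMap_pair_le_one]
  rcases hφ with rfl | ⟨i, rfl⟩ | ⟨i, j, hij, rfl⟩ | rfl | ⟨i, j, hij, rfl⟩ | ⟨i, j, hij, rfl⟩ |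
    ⟨i, rfl⟩ | rfl
  · exact absurd h6 (by decide +kernel)
  · exact absurd h6 (by clear hr hpair h6; revert i; decide +kernel)
  · exact absurd h6 (by clear hr hpair h6; revert i j; decide +kernel)
  · have hv6 : v ∈ fibre K phi6 := hr
    rw [fibre_phi6_eq] at hv6
    obtain ⟨q, -, hq⟩ := Set.mem_iUnion₂.mp hv6
    rw [← eq_of_hasCrossRatio hq hv]
    exact Or.inl hq
  · refine absurd (hv x hx) (hx.not_hasCrossRatio hp hdet hij ((hpair i j).mpr ?_) fun k hi hj h => ?_)
    · clear hr hpair h6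
      revert i j
      decide +kernel
    · rw [hpair] at h
      clear hr hpair h6
      revert i j k
      decide +kernel
  · refine absurd (hv x hx) (hx.not_hasCrossRatio hp hdet hij ((hpair i j).mpr ?_) fun k hi hj h => ?_)
    · clear hr hpair h6
      revert i j
      decide +kernel
    · rw [hpair] at h
      clear hr hpair h6
      revert i j k
      decide +kernel
  · exact Or.inr (Or.inl ⟨i, hr⟩)
  · exact Or.inr (Or.inr hr)

theorem closure_orbit5 [Infinite K] {p : ℙ K (Fin 2 → K)} (hp : p ∈ linePrime K) :
    closure (orbit5 p) = orbit5 p ∪ (⋃ i, fibre K (phi4s i)) ∪ fibre K phi2 := by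
  refine Set.Subset.antisymm (fun v hv => ?_) ?_
  · have h6 : v ∈ {v : MultiProj K 3 4 | rankMap v ≤ phi6} :=
      closure_minimal (fun w hw => (show rankMap w = phi6 from orbit5_subset_fibre hp hw).le)
        (isClosed_rankMap_le phi6_mem) hv
    have hc : v ∈ {v : MultiProj K 3 4 | ∀ x, Represents x v → HasCrossRatio p x} :=
      closure_minimal (t := {v : MultiProj K 3 4 | ∀ x, Represents x v → HasCrossRatio p x})
        (fun w hw x hx => HasCrossRatio.of_orbit5 hw hx) (isClosed_hasCrossRatio p) hv
    rw [Set.union_assoc]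
    refine (mem_orbit5_or_of_hasCrossRatio hp h6 hc).imp_right (Or.imp_left ?_)
    exact fun h => Set.mem_iUnion.mpr h
  · refine Set.union_subset (Set.union_subset subset_closure ?_) ?_
    · exact Set.iUnion_subset fun i => fibre_phi4s_subset_orbit5 hp i
    · exact stratum_subset_of_reachable hp (a := .orb) (b := .fib phi2)
        (.head (.orb_4s 0) (.single (.e4s_2 0)))

theorem disjoint_fibre {φ ψ : Finset (Fin 4) → ℕ} (h : φ ≠ ψ) :
    Disjoint (fibre K φ) (fibre K ψ) :=
  Set.disjoint_left.mpr fun _ hv hv' => h (hv.symm.trans hv')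

theorem disjoint_orbit5_fibre {p : ℙ K (Fin 2 → K)} (hp : p ∈ linePrime K)
    {φ : Finset (Fin 4) → ℕ} (h : phi6 ≠ φ) : Disjoint (orbit5 p) (fibre K φ) :=
  (disjoint_fibre h).mono_left (orbit5_subset_fibre hp)

/-- Every map of the list is the rank map of some point. -/
theorem fibre_nonempty [Infinite K] {φ : Finset (Fin 4) → ℕ} (hφ : φ ∈ phiList) :
    (fibre K φ).Nonempty := by
  by_cases h6 : φ = phi6
  · obtain ⟨p, hp⟩ := linePrime_nonempty (K := K)
    exact ⟨_, h6 ▸ orbit5_subset_fibre hp (repLine_mem_orbit5 p)⟩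
  · obtain ⟨w, hw⟩ := exists_fibre_eq_diagOrbit (K := K) hφ h6
    exact ⟨w, hw ▸ MulAction.mem_orbit_self w⟩

theorem range_rankMap [Infinite K] :
    Set.range (rankMap : MultiProj K 3 4 → Finset (Fin 4) → ℕ) = phiList := by
  refine Set.Subset.antisymm ?_ fun φ hφ => fibre_nonempty hφ
  rintro _ ⟨v, rfl⟩
  exact rankMap_mem_phiList v

theorem closure_stratum [Infinite K] {p : ℙ K (Fin 2 → K)} (hp : p ∈ linePrime K) {a : Node}
    (ha : a ∈ diagram) :
    closure (stratum p a) = ⋃ b ∈ {b | Relation.ReflTransGen Edge a b}, stratum p b := by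
  refine Set.Subset.antisymm (fun v hv => ?_)
    (Set.iUnion₂_subset fun b hb => stratum_subset_of_reachable hp hb)
  rw [Set.mem_iUnion₂]
  rcases ha with rfl | ⟨φ, hφ, rfl⟩
  · change v ∈ closure (orbit5 p) at hv
    rw [closure_orbit5 hp] at hv
    rcases hv with (hv | hv) | hv
    · exact ⟨.orb, .refl, hv⟩
    · obtain ⟨i, hi⟩ := Set.mem_iUnion.mp hv
      exact ⟨.fib (phi4s i), .single (.orb_4s i), hi⟩
    · exact ⟨.fib phi2, .head (.orb_4s 0) (.single (.e4s_2 0)), hv⟩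
  · obtain ⟨ψ, hψ, hv⟩ := Set.mem_iUnion₂.mp (closure_fibre_subset hφ hv)
    exact ⟨.fib ψ, reachable_of_le hφ (mem_phiList_of_mem_fibre hv) hψ, hv⟩

theorem reachable_of_stratum_subset [Infinite K] {p : ℙ K (Fin 2 → K)} (hp : p ∈ linePrime K)
    {a b : Node} (ha : a ∈ diagram) (hb : b ∈ diagram) (h : stratum p b ⊆ closure (stratum p a)) :
    Relation.ReflTransGen Edge a b := by
  rcases ha with rfl | ⟨φ, hφ, rfl⟩ <;> rcases hb with rfl | ⟨ψ, hψ, rfl⟩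
  · exact .refl
  · -- the fibre over `phi6` is excluded, since it contains an orbit `O(5;q)` with `q ≠ p`
    have hψ6 : ψ ≠ phi6 := by
      rintro rfl
      obtain ⟨q, hq, hqp⟩ := (infinite_linePrime (K := K)).exists_notMem_finset {p}
      have hqp : q ≠ p := by simpa using hqp
      have hmem := h (orbit5_subset_fibre hq (repLine_mem_orbit5 q))
      change _ ∈ closure (orbit5 p) at hmem
      rw [closure_orbit5 hp] at hmem
      rcases hmem with (hv | hv) | hv
      · exact Set.disjoint_left.mp (pairwiseDisjoint_orbit5 hq hp hqp) (repLine_mem_orbit5 q) hv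
      · obtain ⟨i, hi⟩ := Set.mem_iUnion.mp hv
        exact Set.disjoint_left.mp
          (disjoint_orbit5_fibre hq (by clear hi; revert i; decide +kernel))
          (repLine_mem_orbit5 q) hi
      · exact Set.disjoint_left.mp (disjoint_orbit5_fibre hq (by decide +kernel))
          (repLine_mem_orbit5 q) hv
    obtain ⟨v, hv⟩ := fibre_nonempty (K := K) hψ
    have hmem := h hv
    change v ∈ closure (orbit5 p) at hmem
    rw [closure_orbit5 hp] at hmem
    have hv' : rankMap v = ψ := hv
    rcases hmem with (hw | hw) | hw
    · exact absurd (hv'.symm.trans (orbit5_subset_fibre hp hw)) hψ6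
    · obtain ⟨i, hi⟩ := Set.mem_iUnion.mp hw
      rw [← hv', show rankMap v = phi4s i from hi]
      exact .single (.orb_4s i)
    · rw [← hv', show rankMap v = phi2 from hw]
      exact .head (.orb_4s 0) (.single (.e4s_2 0))
  · have hmem := closure_fibre_subset hφ (h (repLine_mem_orbit5 p))
    obtain ⟨ψ, hψ, hv⟩ := Set.mem_iUnion₂.mp hmem
    have hψ6 : phi6 = ψ := (orbit5_subset_fibre hp (repLine_mem_orbit5 p)).symm.trans hv
    exact .tail (reachable_of_le hφ phi6_mem (hψ6 ▸ hψ)) .e6_orb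
  · obtain ⟨v, hv⟩ := fibre_nonempty (K := K) hψ
    obtain ⟨χ, hχ, hv'⟩ := Set.mem_iUnion₂.mp (closure_fibre_subset hφ (h hv))
    have : χ = ψ := hv'.symm.trans hv
    exact reachable_of_le hφ hψ (this ▸ hχ)

/-! ### Continuity of the action -/

section Action

open MvPolynomial

/-- Multihomogeneity is preserved when each variable is replaced by a multihomogeneous polynomial of
the same multidegree. -/
theorem IsMultihomogeneous.aeval {n m : ℕ} {f : MvPolynomial (Fin m × Fin n) K} {d : Fin m → ℕ}
    (hf : IsMultihomogeneous f d) {ℓ : Fin m × Fin n → MvPolynomial (Fin m × Fin n) K}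
    (hℓ : ∀ ik, IsMultihomogeneous (ℓ ik) (Pi.single ik.1 1)) :
    IsMultihomogeneous (aeval ℓ f) d := by
  rw [aeval_def, eval₂_eq']
  refine IsWeightedHomogeneous.sum _ _ _ fun e he => ?_
  have h := hf (mem_support_iff.mp he)
  rw [Finsupp.weight_apply, Finsupp.sum_fintype _ _ (by simp)] at h
  rw [← h]
  exact (IsWeightedHomogeneous.prod _ _ _ fun ik _ => (hℓ ik).pow (e ik)).C_mul _

theorem continuous_smul_multiProj (g : GL (Fin 3) K) :
    Continuous fun v : MultiProj K 3 4 => g • v := by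
  rw [continuous_iff_isClosed]
  intro Z hZ
  obtain ⟨S, hS, rfl⟩ := exists_eq_zeroLocus hZ
  let ℓ : Fin 4 × Fin 3 → MvPolynomial (Fin 4 × Fin 3) K := fun ik =>
    ∑ l, C ((g : Matrix (Fin 3) (Fin 3) K) ik.2 l) * X (ik.1, l)
  have hℓ : ∀ ik, IsMultihomogeneous (ℓ ik) (Pi.single ik.1 1) := fun ik =>
    IsWeightedHomogeneous.sum _ _ _ fun l _ => (isMultihomogeneous_X ik.1 l).C_mul _
  have heval : ∀ (x : Fin 4 → Fin 3 → K) f,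
      eval (fun ik : Fin 4 × Fin 3 => x ik.1 ik.2) (aeval ℓ f) =
        eval (fun ik : Fin 4 × Fin 3 => (g • x ik.1) ik.2) f := by
    intro x f
    rw [← coe_aeval_eq_eval, RingHom.coe_coe, ← AlgHom.comp_apply, comp_aeval,
      ← coe_aeval_eq_eval, RingHom.coe_coe]
    congr 2
    funext ik
    simp [ℓ, Units.smul_def, Matrix.smul_eq_mulVec, Matrix.mulVec, dotProduct]
  have : (fun v : MultiProj K 3 4 => g • v) ⁻¹' zeroLocus S =
      zeroLocus ((fun f => MvPolynomial.aeval ℓ f) '' S) := by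
    ext v
    obtain ⟨x, hx⟩ := exists_rep v
    replace hx : Represents x v := hx
    simp only [zeroLocus, Set.mem_preimage, Set.mem_ofPred_eq, Set.forall_mem_image]
    refine forall₂_congr fun f hf => ?_
    obtain ⟨d, hd⟩ := hS f hf
    rw [vanishesAt_iff hd (hx.smul g), vanishesAt_iff (hd.aeval hℓ) hx, heval]
  rw [this]
  refine isClosed_zeroLocus ?_
  rintro _ ⟨f, hf, rfl⟩
  obtain ⟨d, hd⟩ := hS f hf
  exact ⟨d, hd.aeval hℓ⟩

/-- The homeomorphism given by the action of `g`. -/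
noncomputable def smulHomeomorph (g : GL (Fin 3) K) : MultiProj K 3 4 ≃ₜ MultiProj K 3 4 where
  toEquiv := MulAction.toPerm g
  continuous_toFun := continuous_smul_multiProj g
  continuous_invFun := continuous_smul_multiProj g⁻¹

end Action

/-! ### A chart of `O(5;p)` -/

section Chart

open MvPolynomial

/-- The matrix over a ring with the coordinates `y = (a, b, c, d, t)` in a chart of `O(5;p)`, for
`p = [α : β]`: its columns are `x₀ = (1, a, b)`, `x₁ = (1, c, d)`, a multiple `x₂` of the point of
their line with ratio `t` of the first two coordinates, and the point `x₃` of cross-ratio `p`. -/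
def chartPoint {R : Type*} [CommRing R] (α β : R) (y : Fin 5 → R) : Fin 4 → Fin 3 → R :=
  ![![1, y 0, y 1], ![1, y 2, y 3],
    (y 2 - y 4) • ![1, y 0, y 1] + (y 4 - y 0) • ![1, y 2, y 3],
    (α * (y 2 - y 4)) • ![1, y 0, y 1] + (β * (y 4 - y 0)) • ![1, y 2, y 3]]

theorem map_chartPoint {R S : Type*} [CommRing R] [CommRing S] (f : R →+* S) (α β : R)
    (y : Fin 5 → R) (i : Fin 4) (k : Fin 3) :
    f (chartPoint α β y i k) = chartPoint (f α) (f β) (fun j => f (y j)) i k := by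
  fin_cases i <;> fin_cases k <;> simp [chartPoint]

/-- The affine coordinates of the first three columns of a matrix which occur in the chart. -/
def chartCoord (x : Fin 4 → Fin 3 → K) : Fin 5 → K :=
  ![x 0 1 / x 0 0, x 0 2 / x 0 0, x 1 1 / x 1 0, x 1 2 / x 1 0, x 2 1 / x 2 0]

theorem Represents.chartCoord_eq {x y : Fin 4 → Fin 3 → K} {v : MultiProj K 3 4}
    (hx : Represents x v) (hy : Represents y v) : chartCoord x = chartCoord y := by
  have hc : ∀ i, ∃ c : K, c ≠ 0 ∧ x i = c • y i := by
    intro i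
    obtain ⟨c, hc⟩ := (Projectivization.mk_eq_mk_iff K _ _ (hx i).1 (hy i).1).mp
      ((hx i).2.trans (hy i).2.symm)
    exact ⟨c, c.ne_zero, hc.symm⟩
  choose c hc0 hc using hc
  have h : ∀ i k, x i k / x i 0 = y i k / y i 0 := by
    intro i k
    rw [hc i]
    exact mul_div_mul_left _ _ (hc0 i)
  unfold chartCoord
  simp only [h]

/-- The set of the tuples for which the first coordinates of the first three points do not vanish,
and the projections of the first two points to the first two coordinates are distinct. Its
intersection with `O(5;p)` is the domain of the chart. -/
def chartDomain (K : Type*) [Field K] : Set (MultiProj K 3 4) :=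
  {v | ∀ x, Represents x v →
    x 0 0 ≠ 0 ∧ x 1 0 ≠ 0 ∧ x 2 0 ≠ 0 ∧ x 0 0 * x 1 1 - x 0 1 * x 1 0 ≠ 0}

theorem Represents.vanishesAt_X {n m : ℕ} {x : Fin m → Fin n → K} {v : MultiProj K n m}
    (hx : Represents x v) (i : Fin m) (k : Fin n) : VanishesAt (X (i, k)) v ↔ x i k = 0 := by
  rw [vanishesAt_iff (isMultihomogeneous_X i k) hx, eval_X]

theorem Represents.vanishesAt_minorPoly {n m : ℕ} {x : Fin m → Fin n → K} {v : MultiProj K n m}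
    (hx : Represents x v) (i j : Fin m) (a b : Fin n) :
    VanishesAt (minorPoly K i j a b) v ↔ x i a * x j b - x i b * x j a = 0 := by
  rw [vanishesAt_iff (isMultihomogeneous_minorPoly i j a b) hx, eval_minorPoly]

theorem Represents.mem_chartDomain_iff {x : Fin 4 → Fin 3 → K} {v : MultiProj K 3 4}
    (hx : Represents x v) : v ∈ chartDomain K ↔
      x 0 0 ≠ 0 ∧ x 1 0 ≠ 0 ∧ x 2 0 ≠ 0 ∧ x 0 0 * x 1 1 - x 0 1 * x 1 0 ≠ 0 := by
  refine ⟨fun h => h x hx, ?_⟩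
  rintro ⟨h0, h1, h2, h3⟩ y hy
  rw [ne_eq, ← hx.vanishesAt_X, hy.vanishesAt_X] at h0 h1 h2
  rw [ne_eq, ← hx.vanishesAt_minorPoly, hy.vanishesAt_minorPoly] at h3
  exact ⟨h0, h1, h2, h3⟩

theorem isOpen_chartDomain (K : Type*) [Field K] : IsOpen (chartDomain K) := by
  have : chartDomain K =
      ({v | VanishesAt (X (0, 0)) v} ∪ {v | VanishesAt (X (1, 0)) v} ∪ {v | VanishesAt (X (2, 0)) v} ∪
        {v | VanishesAt (minorPoly K 0 1 0 1) v})ᶜ := by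
    ext v
    obtain ⟨x, hx⟩ := exists_rep v
    replace hx : Represents x v := hx
    simp only [Set.mem_compl_iff, Set.mem_union, Set.mem_ofPred_eq, not_or, hx.mem_chartDomain_iff,
      hx.vanishesAt_X, hx.vanishesAt_minorPoly]
    tauto
  rw [this, isOpen_compl_iff]
  exact (((isClosed_setOf_vanishesAt (isMultihomogeneous_X _ _)).union
    (isClosed_setOf_vanishesAt (isMultihomogeneous_X _ _))).union
    (isClosed_setOf_vanishesAt (isMultihomogeneous_X _ _))).union
    (isClosed_setOf_vanishesAt (isMultihomogeneous_minorPoly _ _ _ _))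

/-- The chart is inverse to the affine coordinates. -/
theorem represents_chartPoint {p : ℙ K (Fin 2 → K)} {v : MultiProj K 3 4} (hv : v ∈ orbit5 p ∩ chartDomain K)
    {y : Fin 4 → Fin 3 → K} (hy : Represents y v) :
    Represents (chartPoint (p.rep 0) (p.rep 1) (chartCoord y)) v := by
  obtain ⟨⟨x, hx, -, h2, h3⟩, hv⟩ := hv
  replace hx : Represents x v := hx
  obtain ⟨n0, n1, n2, hm⟩ := hv x hx
  rw [hy.chartCoord_eq hx]
  have n2' : x 0 0 + x 1 0 ≠ 0 := by rwa [h2] at n2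
  have e : ∀ k, x 2 k = x 0 k + x 1 k := fun k => by rw [h2]; rfl
  have e' : ∀ k, x 3 k = p.rep 0 * x 0 k + p.rep 1 * x 1 k := fun k => by rw [h3]; rfl
  let s := (x 1 1 / x 1 0 - x 0 1 / x 0 0) / (x 0 0 + x 1 0)
  have hs : s ≠ 0 := by
    refine div_ne_zero ?_ n2'
    rw [div_sub_div _ _ n1 n0]
    refine div_ne_zero ?_ (mul_ne_zero n1 n0)
    intro h
    exact hm (by linear_combination h)
  refine hx.scale ![(x 0 0)⁻¹, (x 1 0)⁻¹, s, s] ?_ ?_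
  · intro i
    fin_cases i <;> simp [n0, n1, hs]
  · intro i
    ext k
    fin_cases i <;> fin_cases k <;> simp [chartPoint, chartCoord, s, e, e'] <;> field_simp <;> ring

/-- Every polynomial in the coordinates of the chart becomes multihomogeneous after multiplication
by a power of the product of the first coordinates of the first three points. -/
theorem exists_homogenization (q : MvPolynomial (Fin 5) K) :
    ∃ (N : ℕ) (F : MvPolynomial (Fin 4 × Fin 3) K), (∃ d, IsMultihomogeneous F d) ∧
      ∀ x : Fin 4 → Fin 3 → K, x 0 0 ≠ 0 → x 1 0 ≠ 0 → x 2 0 ≠ 0 →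
        eval (fun ik : Fin 4 × Fin 3 => x ik.1 ik.2) F =
          (x 0 0 * x 1 0 * x 2 0) ^ N * eval (chartCoord x) q := by
  -- the multidegree `(N, N, N, 0)` is needed for sums
  let δ : Fin 4 → ℕ := Pi.single 0 1 + Pi.single 1 1 + Pi.single 2 1
  let D : MvPolynomial (Fin 4 × Fin 3) K := X (0, 0) * X (1, 0) * X (2, 0)
  have hX : ∀ j k l, IsMultihomogeneous
      (X (0, j) * X (1, k) * X (2, l) : MvPolynomial (Fin 4 × Fin 3) K) δ := fun j k l =>
    ((isMultihomogeneous_X 0 j).mul (isMultihomogeneous_X 1 k)).mul (isMultihomogeneous_X 2 l)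
  have hD : IsMultihomogeneous D δ := hX 0 0 0
  have hD' : ∀ x : Fin 4 → Fin 3 → K, eval (fun ik : Fin 4 × Fin 3 => x ik.1 ik.2) D =
      x 0 0 * x 1 0 * x 2 0 := fun x => by simp [D]
  suffices ∃ (N : ℕ) (F : MvPolynomial (Fin 4 × Fin 3) K), IsMultihomogeneous F (N • δ) ∧
      ∀ x : Fin 4 → Fin 3 → K, x 0 0 ≠ 0 → x 1 0 ≠ 0 → x 2 0 ≠ 0 →
        eval (fun ik : Fin 4 × Fin 3 => x ik.1 ik.2) F =
          (x 0 0 * x 1 0 * x 2 0) ^ N * eval (chartCoord x) q by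
    obtain ⟨N, F, hF, h⟩ := this
    exact ⟨N, F, ⟨_, hF⟩, h⟩
  induction q using MvPolynomial.induction_on with
  | C a =>
    refine ⟨0, C a, ?_, fun x _ _ _ => by simp⟩
    rw [zero_smul]
    exact isWeightedHomogeneous_C _ a
  | add p q hp hq =>
    obtain ⟨N, F, hF, h⟩ := hp
    obtain ⟨N', F', hF', h'⟩ := hq
    refine ⟨N + N', F * D ^ N' + F' * D ^ N, ?_, fun x h0 h1 h2 => ?_⟩
    · have e := hF.mul (hD.pow N')
      have e' := hF'.mul (hD.pow N)
      rw [← add_smul] at e e'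
      rw [add_comm N' N] at e'
      exact e.add e'
    · simp only [map_add, map_mul, map_pow, h x h0 h1 h2, h' x h0 h1 h2, hD']
      ring
  | mul_X q j hq =>
    obtain ⟨N, F, hF, h⟩ := hq
    have key : ∃ M : MvPolynomial (Fin 4 × Fin 3) K, IsMultihomogeneous M δ ∧
        ∀ x : Fin 4 → Fin 3 → K, x 0 0 ≠ 0 → x 1 0 ≠ 0 → x 2 0 ≠ 0 →
          eval (fun ik : Fin 4 × Fin 3 => x ik.1 ik.2) M =
            x 0 0 * x 1 0 * x 2 0 * chartCoord x j := by
      fin_cases j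
      · refine ⟨_, hX 1 0 0, fun x h0 h1 h2 => ?_⟩
        simp [chartCoord]
        field_simp
      · refine ⟨_, hX 2 0 0, fun x h0 h1 h2 => ?_⟩
        simp [chartCoord]
        field_simp
      · refine ⟨_, hX 0 1 0, fun x h0 h1 h2 => ?_⟩
        simp [chartCoord]
        field_simp
      · refine ⟨_, hX 0 2 0, fun x h0 h1 h2 => ?_⟩
        simp [chartCoord]
        field_simp
      · refine ⟨_, hX 0 0 1, fun x h0 h1 h2 => ?_⟩
        simp [chartCoord]
        field_simp
    obtain ⟨M, hM, hM'⟩ := key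
    refine ⟨N + 1, F * M, ?_, fun x h0 h1 h2 => ?_⟩
    · rw [add_smul, one_smul]
      exact hF.mul hM
    · simp only [map_mul, h x h0 h1 h2, hM' x h0 h1 h2, eval_X]
      ring

/-- The coordinates of the chart, as a map to the affine space `𝔸⁵`. -/
noncomputable def chartMap (p : ℙ K (Fin 2 → K)) (v : ↥(orbit5 p ∩ chartDomain K)) :
    PrimeSpectrum (MvPolynomial (Fin 5) K) :=
  ⟨RingHom.ker (eval (chartCoord fun i => (v.1 i).rep)), RingHom.ker_isPrime _⟩

theorem mem_chartMap_iff {p : ℙ K (Fin 2 → K)} {v : ↥(orbit5 p ∩ chartDomain K)}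
    {x : Fin 4 → Fin 3 → K} (hx : Represents x v.1) (q : MvPolynomial (Fin 5) K) :
    q ∈ (chartMap p v).asIdeal ↔ eval (chartCoord x) q = 0 := by
  have hr : Represents (fun i => (v.1 i).rep) v.1 :=
    fun i => ⟨(v.1 i).rep_nonzero, (v.1 i).mk_rep⟩
  rw [hx.chartCoord_eq hr]
  exact RingHom.mem_ker

theorem isInducing_chartMap (p : ℙ K (Fin 2 → K)) : Topology.IsInducing (chartMap p) := by
  refine ⟨TopologicalSpace.ext_iff_isClosed.mpr fun Z => ?_⟩
  constructor
  · intro hZ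
    obtain ⟨Z', hZ', rfl⟩ := isClosed_induced_iff.mp hZ
    refine isClosed_induced_iff.mpr ?_
    obtain ⟨S, hS, rfl⟩ := exists_eq_zeroLocus hZ'
    let M : Fin 4 → Fin 3 → MvPolynomial (Fin 5) K := chartPoint (C (p.rep 0)) (C (p.rep 1)) X
    refine ⟨PrimeSpectrum.zeroLocus ((fun f => aeval (fun ik : Fin 4 × Fin 3 => M ik.1 ik.2) f) '' S),
      PrimeSpectrum.isClosed_zeroLocus _, ?_⟩
    ext v
    obtain ⟨x, hx⟩ := exists_rep v.1
    replace hx : Represents x v.1 := hx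
    simp only [Set.mem_preimage, PrimeSpectrum.mem_zeroLocus, Set.image_subset_iff, zeroLocus,
      Set.mem_ofPred_eq]
    refine forall₂_congr fun f hf => ?_
    obtain ⟨d, hd⟩ := hS f hf
    rw [vanishesAt_iff hd (represents_chartPoint v.2 hx), Set.mem_preimage, SetLike.mem_coe,
      mem_chartMap_iff hx]
    have e : eval (chartCoord x) (aeval (fun ik : Fin 4 × Fin 3 => M ik.1 ik.2) f) =
        eval (fun ik : Fin 4 × Fin 3 => chartPoint (p.rep 0) (p.rep 1) (chartCoord x) ik.1 ik.2) f := by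
      rw [← coe_aeval_eq_eval, RingHom.coe_coe, ← AlgHom.comp_apply, comp_aeval,
        ← coe_aeval_eq_eval, RingHom.coe_coe]
      congr 2
      funext ik
      rw [← RingHom.coe_coe, coe_aeval_eq_eval]
      simp only [M, map_chartPoint, eval_C, eval_X]
    rw [e]
  · intro hZ
    obtain ⟨T, hT, rfl⟩ := isClosed_induced_iff.mp hZ
    obtain ⟨T, rfl⟩ := (PrimeSpectrum.isClosed_iff_zeroLocus T).mp hT
    have : chartMap p ⁻¹' PrimeSpectrum.zeroLocus T = ⋂ q ∈ T,
        chartMap p ⁻¹' PrimeSpectrum.zeroLocus {q} := by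
      ext v
      simp [PrimeSpectrum.mem_zeroLocus, Set.subset_def]
    rw [this]
    refine isClosed_biInter fun q _ => ?_
    obtain ⟨N, F, ⟨d, hd⟩, hF⟩ := exists_homogenization q
    refine isClosed_induced_iff.mpr ⟨_, isClosed_setOf_vanishesAt hd, ?_⟩
    ext v
    obtain ⟨x, hx⟩ := exists_rep v.1
    replace hx : Represents x v.1 := hx
    obtain ⟨h0, h1, h2, -⟩ := v.2.2 x hx
    simp only [Set.mem_preimage, PrimeSpectrum.mem_zeroLocus, Set.singleton_subset_iff,
      SetLike.mem_coe, mem_chartMap_iff hx, Set.mem_ofPred_eq]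
    rw [vanishesAt_iff hd hx, hF x h0 h1 h2, mul_eq_zero, or_iff_right]
    exact pow_ne_zero _ (mul_ne_zero (mul_ne_zero h0 h1) h2)

theorem topologicalKrullDim_chartDomain_le (p : ℙ K (Fin 2 → K)) :
    topologicalKrullDim ↥(orbit5 p ∩ chartDomain K) ≤ 5 := by
  refine (isInducing_chartMap p).topologicalKrullDim_le.trans ?_
  rw [PrimeSpectrum.topologicalKrullDim_eq_ringKrullDim,
    MvPolynomial.ringKrullDim_of_isNoetherianRing, ringKrullDim_eq_zero_of_field]
  simp

end Chart

/-! ### The dimension of `O(5;p)` -/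

/-- The Krull dimension may be bounded locally. -/
theorem topologicalKrullDim_le_of_forall_exists {X : Type*} [TopologicalSpace X] {n : WithBot ℕ∞}
    (h : ∀ x : X, ∃ U : Set X, IsOpen U ∧ x ∈ U ∧ topologicalKrullDim U ≤ n) :
    topologicalKrullDim X ≤ n := by
  refine iSup_le fun s => ?_
  obtain ⟨x, hx⟩ := s.head.isIrreducible.nonempty
  obtain ⟨U, hU, hxU, hn⟩ := h x
  refine le_trans ?_ hn
  have hemb := hU.isOpenEmbedding_subtypeVal
  let e := TopologicalSpace.IrreducibleCloseds.orderIsoOfIsOpenEmbedding _ hemb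
  let s' : LTSeries {V : TopologicalSpace.IrreducibleCloseds X |
      ((Subtype.val : U → X) ⁻¹' V).Nonempty} :=
    { length := s.length
      toFun := fun i => ⟨s i, ⟨⟨x, hxU⟩, (LTSeries.head_le s i) hx⟩⟩
      step := fun i => s.step i }
  exact Order.LTSeries.length_le_krullDim (s'.map e.symm e.symm.strictMono)

theorem topologicalKrullDim_orbit5_le {p : ℙ K (Fin 2 → K)} [CharZero K] :
    topologicalKrullDim (orbit5 p) ≤ 5 := by
  refine topologicalKrullDim_le_of_forall_exists fun ⟨v, hv⟩ => ?_
  -- translate `v` to a point of the domain of the chart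
  obtain ⟨g, hg⟩ : ∃ g : GL (Fin 3) K, g • v ∈ chartDomain K := by
    rw [orbit5_eq_diagOrbit] at hv
    obtain ⟨h, rfl⟩ := hv
    let g : GL (Fin 3) K := Matrix.GeneralLinearGroup.mkOfDetNeZero
      !![1, 1, 0; 0, 1, 0; 0, 0, 1] (by simp [Matrix.det_fin_three])
    refine ⟨g * h⁻¹, ?_⟩
    change (g * h⁻¹) • h • repLine p ∈ chartDomain K
    rw [mul_smul, inv_smul_smul, ((represents_repLine p).smul g).mem_chartDomain_iff]
    have hg : ∀ y : Fin 3 → K, g • y = ![y 0 + y 1, y 1, y 2] := fun y => by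
      change Matrix.mulVec !![1, 1, 0; 0, 1, 0; 0, 0, 1] y = _
      ext k
      fin_cases k <;> simp [Matrix.mulVec, dotProduct, Fin.sum_univ_three]
    simp only [hg, Matrix.cons_val]
    norm_num
  refine ⟨{w | g • w.1 ∈ chartDomain K}, ?_, hg, ?_⟩
  · exact (isOpen_chartDomain K).preimage
      ((continuous_smul_multiProj g).comp continuous_subtype_val)
  · refine le_trans ?_ (topologicalKrullDim_chartDomain_le p)
    let f : {w : orbit5 p | g • w.1 ∈ chartDomain K} → ↥(orbit5 p ∩ chartDomain K) :=
      fun w => ⟨g • w.1.1, smul_mem_orbit5 w.1.2 g, w.2⟩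
    have hf : Topology.IsInducing f := by
      rw [← Topology.IsInducing.subtypeVal.of_comp_iff]
      exact (smulHomeomorph g).isInducing.comp
        (Topology.IsInducing.subtypeVal.comp Topology.IsInducing.subtypeVal)
    exact hf.topologicalKrullDim_le

section LowerBound

open MvPolynomial

/-- Over an infinite field, the image of a nonempty principal open subset of an affine space under
a polynomial map is irreducible. -/
theorem isPreirreducible_of_parametrization [Infinite K] {ι : Type*} {n m : ℕ}
    (M : Fin m → Fin n → MvPolynomial ι K) (Q : MvPolynomial ι K)
    (hQ : ∀ y, eval y Q ≠ 0 → ∀ i, (fun k => eval y (M i k)) ≠ 0) :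
    IsPreirreducible {v : MultiProj K n m | ∃ y, eval y Q ≠ 0 ∧
      Represents (fun i k => eval y (M i k)) v} := by
  have key : ∀ U : Set (MultiProj K n m), IsOpen U → ∀ v, v ∈ U → ∀ y, eval y Q ≠ 0 →
      Represents (fun i k => eval y (M i k)) v → ∃ q : MvPolynomial ι K, q ≠ 0 ∧
        ∀ z w, eval z q ≠ 0 → Represents (fun i k => eval z (M i k)) w → w ∈ U := by
    intro U hU v hv y _ hr
    obtain ⟨S, hS, e⟩ := exists_eq_zeroLocus hU.isClosed_compl
    have heval : ∀ z f, eval z (aeval (fun ik : Fin m × Fin n => M ik.1 ik.2) f) =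
        eval (fun ik : Fin m × Fin n => eval z (M ik.1 ik.2)) f := by
      intro z f
      rw [← coe_aeval_eq_eval, RingHom.coe_coe, ← AlgHom.comp_apply, comp_aeval,
        ← coe_aeval_eq_eval, RingHom.coe_coe]
    have hv' : v ∉ zeroLocus S := by
      rw [← e]
      exact fun h => h hv
    simp only [zeroLocus, Set.mem_ofPred_eq, not_forall] at hv'
    obtain ⟨f, hf, hfv⟩ := hv'
    obtain ⟨d, hd⟩ := hS f hf
    rw [vanishesAt_iff hd hr, ← heval] at hfv
    refine ⟨aeval (fun ik : Fin m × Fin n => M ik.1 ik.2) f, fun h => hfv (by rw [h, map_zero]),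
      fun z w hz hw => ?_⟩
    by_contra hwU
    have hwS : w ∈ zeroLocus S := e ▸ hwU
    have := hwS f hf
    rw [vanishesAt_iff hd hw, ← heval] at this
    exact hz this
  rintro U V hU hV ⟨v, ⟨y, hy, hv⟩, hvU⟩ ⟨w, ⟨z, hz, hw⟩, hwV⟩
  obtain ⟨q, hq, hqU⟩ := key U hU v hvU y hy hv
  obtain ⟨r, hr, hrV⟩ := key V hV w hwV z hz hw
  have hQ0 : Q ≠ 0 := fun h => hy (by rw [h, map_zero])
  obtain ⟨u, hu⟩ : ∃ u, eval u (q * r * Q) ≠ 0 := by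
    by_contra! h
    exact mul_ne_zero (mul_ne_zero hq hr) hQ0 (MvPolynomial.funext fun u => by rw [h, map_zero])
  rw [map_mul, map_mul] at hu
  have hu2 := right_ne_zero_of_mul hu
  have hu1 := right_ne_zero_of_mul (left_ne_zero_of_mul hu)
  have hu0 := left_ne_zero_of_mul (left_ne_zero_of_mul hu)
  have hrep : Represents (fun i k => eval u (M i k))
      (fun i => Projectivization.mk K (fun k => eval u (M i k)) (hQ u hu2 i)) := fun i => ⟨_, rfl⟩
  exact ⟨_, ⟨u, hu2, hrep⟩, hqU u _ hu0 hrep, hrV u _ hu1 hrep⟩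

/-- The polynomial which must not vanish for `chartPoint` to give a point of `O(5;p)`. -/
def chartDenom {R : Type*} [CommRing R] (y : Fin 5 → R) : R :=
  (y 2 - y 0) * (y 2 - y 4) * (y 4 - y 0)

theorem represents_chartPoint_mem_orbit5 {p : ℙ K (Fin 2 → K)} {y : Fin 5 → K}
    (hy : chartDenom y ≠ 0) {v : MultiProj K 3 4}
    (hv : Represents (chartPoint (p.rep 0) (p.rep 1) y) v) : v ∈ orbit5 p := by
  have h1 : y 4 - y 0 ≠ 0 := right_ne_zero_of_mul hy
  have h2 : y 2 - y 4 ≠ 0 := right_ne_zero_of_mul (left_ne_zero_of_mul hy)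
  have h3 : y 2 - y 0 ≠ 0 := left_ne_zero_of_mul (left_ne_zero_of_mul hy)
  refine ⟨_, hv.scale (y := fun i => (![y 2 - y 4, y 4 - y 0, 1, 1] : Fin 4 → K) i •
    chartPoint (p.rep 0) (p.rep 1) y i) ![y 2 - y 4, y 4 - y 0, 1, 1] ?_ (fun _ => rfl), ?_, ?_, ?_⟩
  · intro i
    fin_cases i <;> simp [h1, h2]
  · intro h
    rw [hv.eq_iff_minors] at h
    have := h 1 0
    simp [chartPoint] at this
    exact h3 (by rw [this, sub_self])
  · ext k
    fin_cases k <;> simp [chartPoint]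
  · ext k
    fin_cases k <;> simp [chartPoint] <;> ring

theorem chartPoint_ne_zero {p : ℙ K (Fin 2 → K)} (hp : p ∈ linePrime K) {y : Fin 5 → K}
    (hy : chartDenom y ≠ 0) (i : Fin 4) : chartPoint (p.rep 0) (p.rep 1) y i ≠ 0 := by
  obtain ⟨p0, -, -⟩ := (mem_linePrime_iff p).mp hp
  have h1 : y 4 - y 0 ≠ 0 := right_ne_zero_of_mul hy
  have h2 : y 2 - y 4 ≠ 0 := right_ne_zero_of_mul (left_ne_zero_of_mul hy)
  have h3 : y 2 - y 0 ≠ 0 := left_ne_zero_of_mul (left_ne_zero_of_mul hy)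
  intro h
  have e0 := congrFun h 0
  have e1 := congrFun h 1
  fin_cases i
  · simp [chartPoint] at e0
  · simp [chartPoint] at e0
  · simp [chartPoint] at e0
    exact h3 (by linear_combination e0)
  · simp [chartPoint] at e0 e1
    refine mul_ne_zero p0 (mul_ne_zero h2 h3) ?_
    linear_combination y 2 * e0 - e1

/-- The base point of the flag of coordinate subspaces in the chart. -/
def flagBase (K : Type*) [Field K] : Fin 5 → K := ![0, 0, 1, 0, 2]

/-- The points of the chart whose coordinates from the `k`-th on are those of `flagBase`. -/
def flagSet (p : ℙ K (Fin 2 → K)) (k : ℕ) : Set (MultiProj K 3 4) :=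
  {v | ∃ y : Fin 5 → K, (∀ j : Fin 5, k ≤ j → y j = flagBase K j) ∧ chartDenom y ≠ 0 ∧
    Represents (chartPoint (p.rep 0) (p.rep 1) y) v}

theorem flagSet_mono (p : ℙ K (Fin 2 → K)) {k l : ℕ} (h : k ≤ l) : flagSet p k ⊆ flagSet p l :=
  fun _ ⟨y, hy, hd, hr⟩ => ⟨y, fun j hj => hy j (h.trans hj), hd, hr⟩

theorem flagSet_subset_orbit5 (p : ℙ K (Fin 2 → K)) (k : ℕ) : flagSet p k ⊆ orbit5 p :=
  fun _ ⟨_, _, hd, hr⟩ => represents_chartPoint_mem_orbit5 hd hr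

theorem isPreirreducible_flagSet [Infinite K] {p : ℙ K (Fin 2 → K)} (hp : p ∈ linePrime K)
    (k : ℕ) : IsPreirreducible (flagSet p k) := by
  let y : Fin 5 → MvPolynomial (Fin 5) K := fun j => if k ≤ j then C (flagBase K j) else X j
  have hy : ∀ (z : Fin 5 → K) i l,
      eval z (chartPoint (C (p.rep 0)) (C (p.rep 1)) y i l) =
        chartPoint (p.rep 0) (p.rep 1) (fun j => eval z (y j)) i l := fun z i l => by
    simp only [map_chartPoint, eval_C]
  have hd : ∀ z : Fin 5 → K, eval z (chartDenom y) = chartDenom fun j => eval z (y j) := fun z => by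
    simp [chartDenom]
  convert isPreirreducible_of_parametrization (K := K) (ι := Fin 5) (n := 3) (m := 4)
    (chartPoint (C (p.rep 0)) (C (p.rep 1)) y) (chartDenom y) ?_ using 1
  · ext v
    simp only [flagSet, Set.mem_ofPred_eq, hy, hd]
    constructor
    · rintro ⟨z, hz, hzd, hr⟩
      have e : (fun j => eval z (y j)) = z := by
        funext j
        simp only [y]
        split_ifs with h
        · rw [eval_C, hz j h]
        · rw [eval_X]
      exact ⟨z, by rwa [e], by rwa [e]⟩
    · rintro ⟨z, hzd, hr⟩
      refine ⟨fun j => eval z (y j), fun j hj => ?_, hzd, hr⟩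
      simp only [y, if_pos hj, eval_C]
  · intro z hz i
    simp only [hy]
    rw [hd] at hz
    exact chartPoint_ne_zero hp hz i

/-- The closed condition saying that the `k`-th coordinate in the chart is that of `flagBase`. -/
theorem exists_isClosed_flagCoord (p : ℙ K (Fin 2 → K)) (k : Fin 5) :
    ∃ Z : Set (MultiProj K 3 4), IsClosed Z ∧ ∀ v (y : Fin 5 → K), chartDenom y ≠ 0 →
      Represents (chartPoint (p.rep 0) (p.rep 1) y) v → (v ∈ Z ↔ y k = flagBase K k) := by
  let L : Fin 4 → Fin 3 → MvPolynomial (Fin 4 × Fin 3) K := fun i l =>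
    X (i, l) - C (flagBase K k) * X (i, 0)
  have hL : ∀ i l, IsMultihomogeneous (L i l) (Pi.single i 1) := fun i l =>
    (isMultihomogeneous_X i l).sub ((isMultihomogeneous_X i 0).C_mul _)
  suffices ∃ i l, ∀ y : Fin 5 → K, chartDenom y ≠ 0 →
      (chartPoint (p.rep 0) (p.rep 1) y i l -
        flagBase K k * chartPoint (p.rep 0) (p.rep 1) y i 0 = 0 ↔ y k = flagBase K k) by
    obtain ⟨i, l, h⟩ := this
    refine ⟨_, isClosed_setOf_vanishesAt (hL i l), fun v y hy hv => ?_⟩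
    rw [Set.mem_ofPred_eq, vanishesAt_iff (hL i l) hv, ← h y hy]
    simp [L]
  fin_cases k
  · exact ⟨0, 1, fun y _ => by simp [chartPoint, sub_eq_zero]⟩
  · exact ⟨0, 2, fun y _ => by simp [chartPoint, sub_eq_zero]⟩
  · exact ⟨1, 1, fun y _ => by simp [chartPoint, sub_eq_zero]⟩
  · exact ⟨1, 2, fun y _ => by simp [chartPoint, sub_eq_zero]⟩
  · refine ⟨2, 1, fun y hy => ?_⟩
    have h3 : y 2 - y 0 ≠ 0 := left_ne_zero_of_mul (left_ne_zero_of_mul hy)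
    have e : chartPoint (p.rep 0) (p.rep 1) y 2 1 - flagBase K 4 *
        chartPoint (p.rep 0) (p.rep 1) y 2 0 = (y 2 - y 0) * (y 4 - flagBase K 4) := by
      simp [chartPoint]
      ring
    change chartPoint (p.rep 0) (p.rep 1) y 2 1 - flagBase K 4 *
        chartPoint (p.rep 0) (p.rep 1) y 2 0 = 0 ↔ y 4 = flagBase K 4
    rw [e, mul_eq_zero, or_iff_right h3, sub_eq_zero]

theorem not_flagSet_subset [CharZero K] {p : ℙ K (Fin 2 → K)} (hp : p ∈ linePrime K) (k : Fin 5) :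
    ∃ v ∈ flagSet p (k + 1), v ∉ closure (flagSet p k) := by
  obtain ⟨Z, hZ, h⟩ := exists_isClosed_flagCoord p k
  let y : Fin 5 → K := Function.update (flagBase K) k (flagBase K k + 3)
  have hy : chartDenom y ≠ 0 := by
    fin_cases k <;> simp [y, chartDenom, flagBase] <;> norm_num
  have hr : Represents (chartPoint (p.rep 0) (p.rep 1) y) _ :=
    represents_tuple _ (chartPoint_ne_zero hp hy)
  refine ⟨_, ⟨y, fun j hj => ?_, hy, hr⟩, fun hv => ?_⟩
  · exact Function.update_of_ne (fun e => by subst e; omega) _ _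
  · have hsub : flagSet p k ⊆ Z := by
      rintro w ⟨z, hz, hzd, hw⟩
      exact (h w z hzd hw).mpr (hz k le_rfl)
    have := (h _ y hy hr).mp (closure_minimal hsub hZ hv)
    simp [y] at this

/-- The chain of the closures of the coordinate subspaces in the chart. -/
theorem five_le_topologicalKrullDim_orbit5 [CharZero K] {p : ℙ K (Fin 2 → K)}
    (hp : p ∈ linePrime K) : 5 ≤ topologicalKrullDim (orbit5 p) := by
  have : Infinite K := CharZero.infinite K
  let E : ℕ → Set (orbit5 p) := fun k => Subtype.val ⁻¹' flagSet p k
  have hbase : chartDenom (flagBase K) ≠ 0 := by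
    simp [chartDenom, flagBase]
    norm_num
  have hr := represents_tuple _ (chartPoint_ne_zero hp hbase)
  have hE : ∀ k, IsIrreducible (E k) := by
    refine fun k => ⟨⟨⟨_, represents_chartPoint_mem_orbit5 hbase hr⟩, flagBase K, fun _ _ => rfl,
      hbase, hr⟩, ?_⟩
    rintro U V hU hV ⟨v, hv, hvU⟩ ⟨w, hw, hwV⟩
    obtain ⟨U', hU', rfl⟩ := isOpen_induced_iff.mp hU
    obtain ⟨V', hV', rfl⟩ := isOpen_induced_iff.mp hV
    obtain ⟨u, hu, huU⟩ := isPreirreducible_flagSet hp k U' V' hU' hV' ⟨v, hv, hvU⟩ ⟨w, hw, hwV⟩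
    exact ⟨⟨u, flagSet_subset_orbit5 p k hu⟩, hu, huU⟩
  let Z : ℕ → TopologicalSpace.IrreducibleCloseds (orbit5 p) := fun k =>
    ⟨closure (E k), (hE k).closure, isClosed_closure⟩
  let s : LTSeries (TopologicalSpace.IrreducibleCloseds (orbit5 p)) :=
    { length := 5
      toFun := fun k => Z k
      step := fun k => by
        refine lt_of_le_of_ne (closure_mono (Set.preimage_mono (flagSet_mono p ?_))) fun h => ?_
        · simp
        · obtain ⟨v, hv, hvn⟩ := not_flagSet_subset hp k
          have hv' : (⟨v, flagSet_subset_orbit5 p _ hv⟩ : orbit5 p) ∈ closure (E (k + 1)) :=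
            subset_closure hv
          have h : closure (E k) = closure (E (k + 1)) := h
          rw [← h, closure_subtype] at hv'
          exact hvn (closure_mono (Set.image_preimage_subset _ _) hv') }
  exact Order.LTSeries.length_le_krullDim s

end LowerBound

theorem topologicalKrullDim_orbit5 [CharZero K] {p : ℙ K (Fin 2 → K)} (hp : p ∈ linePrime K) :
    topologicalKrullDim (orbit5 p) = 5 :=
  le_antisymm topologicalKrullDim_orbit5_le (five_le_topologicalKrullDim_orbit5 hp)

end QuadProj

theorem theoremB (K : Type*) [Field K] [IsAlgClosed K] [CharZero K] :
    -- the rank map is invariant, and its image is the explicit list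
    (∀ (g : GL (Fin 3) K) (v : MultiProj K 3 4), rankMap (g • v) = rankMap v) ∧
    Set.range (rankMap : MultiProj K 3 4 → Finset (Fin 4) → ℕ) = phiList ∧
    -- every fibre other than the one over `φ[6]` is a single orbit
    (∀ φ ∈ phiList, φ ≠ phi6 → ∀ v ∈ fibre K φ, fibre K φ = diagOrbit v) ∧
    -- representatives, for all positions of the indices
    fibre K phi2 = diagOrbit (rep2 K) ∧
    (∀ σ : Equiv.Perm (Fin 4), fibre K (phi4s (σ 0)) = diagOrbit (permTuple σ (rep4s K))) ∧
    (∀ σ : Equiv.Perm (Fin 4), fibre K (phi4p (σ 0) (σ 1)) = diagOrbit (permTuple σ (rep4p K))) ∧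
    (∀ σ : Equiv.Perm (Fin 4), fibre K (phi5 (σ 0) (σ 1)) = diagOrbit (permTuple σ (rep5 K))) ∧
    (∀ σ : Equiv.Perm (Fin 4), fibre K (phi6p (σ 2) (σ 3)) = diagOrbit (permTuple σ (rep6p K))) ∧
    (∀ σ : Equiv.Perm (Fin 4), fibre K (phi7 (σ 0)) = diagOrbit (permTuple σ (rep7 K))) ∧
    fibre K phi8 = diagOrbit (rep8 K) ∧
    -- the fibre over `φ[6]` is the disjoint union of the infinitely many 5-dimensional orbits `O(5;p)`
    (∀ p ∈ linePrime K, orbit5 p = diagOrbit (repLine p)) ∧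
    (∀ p ∈ linePrime K, topologicalKrullDim (orbit5 p) = 5) ∧
    fibre K phi6 = (⋃ p ∈ linePrime K, orbit5 p) ∧
    (linePrime K).PairwiseDisjoint orbit5 ∧
    (orbit5 '' linePrime K).Infinite ∧
    -- closures of the fibres
    (∀ φ ∈ Set.range (rankMap : MultiProj K 3 4 → Finset (Fin 4) → ℕ),
      closure (fibre K φ) = (⋃ ψ ≤ φ, fibre K ψ)) ∧
    -- closures of the orbits `O(5;p)`
    (∀ p ∈ linePrime K,
      closure (orbit5 p) = orbit5 p ∪ (⋃ i, fibre K (phi4s i)) ∪ fibre K phi2 ∧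
      Disjoint (orbit5 p) (⋃ i, fibre K (phi4s i)) ∧
      Pairwise (fun i j : Fin 4 => Disjoint (fibre K (phi4s i)) (fibre K (phi4s j))) ∧
      Disjoint (orbit5 p ∪ ⋃ i, fibre K (phi4s i)) (fibre K phi2)) ∧
    -- the closure relations are given by the Hasse diagram
    (∀ p ∈ linePrime K, ∀ a ∈ diagram,
      closure (stratum p a) = (⋃ b ∈ {b | Relation.ReflTransGen Edge a b}, stratum p b) ∧
      ∀ b ∈ diagram, stratum p b ⊆ closure (stratum p a) ↔ Relation.ReflTransGen Edge a b) := by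
  have : Infinite K := CharZero.infinite K
  refine ⟨fun g v => rankMap_smul g v, range_rankMap,
    fun φ hφ h6 v hv => fibre_eq_diagOrbit_of_mem hφ h6 hv, fibre_phi2, fibre_phi4s, fibre_phi4p,
    fibre_phi5, fibre_phi6p, fibre_phi7, fibre_phi8, fun p _ => orbit5_eq_diagOrbit p,
    fun p hp => topologicalKrullDim_orbit5 hp, fibre_phi6_eq, pairwiseDisjoint_orbit5,
    infinite_orbit5, fun φ hφ => closure_fibre (range_rankMap (K := K) ▸ hφ),
    fun p hp => ⟨closure_orbit5 hp, ?_, ?_, ?_⟩,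
    fun p hp a ha => ⟨closure_stratum hp ha, fun b hb =>
      ⟨reachable_of_stratum_subset hp ha hb, stratum_subset_of_reachable hp⟩⟩⟩
  · exact Set.disjoint_iUnion_right.mpr fun i =>
      disjoint_orbit5_fibre hp (by revert i; decide +kernel)
  · exact fun i j hij => disjoint_fibre (by revert i j; decide +kernel)
  · rw [Set.disjoint_union_left, Set.disjoint_iUnion_left]
    exact ⟨disjoint_orbit5_fibre hp (by decide +kernel),
      fun i => disjoint_fibre (by revert i; decide +kernel)⟩
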